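/- **Proposition 1.2.** Let $M$ and $N$ be smooth manifolds (finite-dimensional, Hausdorff, second countable, without boundary), and let $\Sigma$ be an $a$-regular stratification of a closed subset $S\subset N$. Then: (a) $T_\Sigma=\{f\in C^\infty(M,N) : f\pitchfork\Sigma\}$ is dense in $C^\infty(M,N)$ both for the weak topology and for the strong (Whitney) topology. (b) For $K\subset M$, the set $T_K=\{f\in C^\infty(M,N) : f\pitchfork_K\Sigma\}$ is open in $C^\infty(M,N)$ for the weak topology if $K$ is compact, and for the strong topology if $K$ is closed. Here a *stratification* $\Sigma$ of $S$ is a partition of $S$ into smooth embedded submanifolds of $N$ (the *strata*; they need not be closed in $N$ and may have equal dimensions) which is locally finite: each point of $S$ has a neighbourhood meeting only finitely many strata. It is *$a$-regular* if for any two distinct strata $A,B$, every $x\in A\cap\overline{B}$ and every sequence $(y_i)$ in $B$ with $y_i\to x$ whose tangent spaces $T_{y_i}B$ converge (in the Grassmannian, in a chart around $x$) to a subspace $\tau\subset T_xN$, one has $T_xA\subset\tau$. A smooth map $f$ is *transverse to $\Sigma$ at $x$* if for every stratum $A$ with $f(x)\in A$ one has $T_{f(x)}A+Df_x(T_xM)=T_{f(x)}N$;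 we write $f\pitchfork_K\Sigma$ if this holds at all $x\in K$, and $f\pitchfork\Sigma$ if it holds at all $x\in M$. For $f\in C^\infty(M,N)$, $r\in\mathbb N$, smooth charts $(\varphi,U)$ of $M$ and $(\psi,V)$ of $N$, a compact $K\subset U$ with $f(K)\subset V$, and $\varepsilon>0$, let $\mathcal N^r(f;\varphi,\psi,K,\varepsilon)$ be the set of $g\in C^\infty(M,N)$ with $g(K)\subset V$ and $\|D^k(\psi f\varphi^{-1})(y)-D^k(\psi g\varphi^{-1})(y)\|<\varepsilon$ for all $y\in\varphi(K)$ and $0\le k\le r$. The *weak topology* is generated by all these sets; the *strong topology* is generated by all intersections $\bigcap_i\mathcal N^r(f;\varphi_i,\psi_i,K_i,\varepsilon_i)$ with $f$ and $r$ fixed, over families for which the chart domains $U_i$ form a locally finite family in $M$. -/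

import Mathlib

open Set Filter Topology
open scoped Manifold ContDiff

noncomputable section

namespace StratTransverse

/-- `ℝⁿ` with its Euclidean norm. -/
abbrev Euc (n : ℕ) : Type := EuclideanSpace ℝ (Fin n)

/-! ### The weak and the strong (Whitney) topology on `C^∞(M, N)` -/

section FunctionSpaces

variable {m n : ℕ} {M N : Type*}
  [TopologicalSpace M] [ChartedSpace (Euc m) M]
  [TopologicalSpace N] [ChartedSpace (Euc n) N]

/-- The set of smooth maps `g` with `g(K) ⊆ V` and
`‖D^k(ψ f φ⁻¹)(y) - D^k(ψ g φ⁻¹)(y)‖ < ε` for all `y ∈ φ(K)` and all `k = 0, …, r`,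
where `(φ, U)` is a chart of `M`, `(ψ, V)` is a chart of `N` and `K ⊆ U`, `f(K) ⊆ V`
(these conditions are imposed where the set is used). -/
def chartNhd (r : ℕ) (f : C^∞⟮𝓡 m, M; 𝓡 n, N⟯) (φ : OpenPartialHomeomorph M (Euc m))
    (ψ : OpenPartialHomeomorph N (Euc n)) (K : Set M) (ε : ℝ) :
    Set C^∞⟮𝓡 m, M; 𝓡 n, N⟯ :=
  {g | MapsTo g K ψ.source ∧ ∀ y ∈ φ '' K, ∀ k ≤ r,
    ‖iteratedFDeriv ℝ k (ψ ∘ f ∘ φ.symm) y - iteratedFDeriv ℝ k (ψ ∘ g ∘ φ.symm) y‖ < ε}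

/-- The weak topology (`C^∞` compact-open topology) on `C^∞(M, N)`: it is generated by the sets
`chartNhd r f φ ψ K ε` with `r` finite, `φ`, `ψ` smooth charts, `K` a compact subset of the domain
of `φ` which `f` maps into the domain of `ψ`, and `ε > 0`. -/
@[reducible] def weakTopology (m n : ℕ) (M N : Type*)
    [TopologicalSpace M] [ChartedSpace (Euc m) M]
    [TopologicalSpace N] [ChartedSpace (Euc n) N] :
    TopologicalSpace C^∞⟮𝓡 m, M; 𝓡 n, N⟯ :=
  TopologicalSpace.generateFrom
    {W | ∃ (r : ℕ) (f : C^∞⟮𝓡 m, M; 𝓡 n, N⟯) (φ : OpenPartialHomeomorph M (Euc m))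
        (ψ : OpenPartialHomeomorph N (Euc n)) (K : Set M) (ε : ℝ),
      φ ∈ IsManifold.maximalAtlas (𝓡 m) ∞ M ∧ ψ ∈ IsManifold.maximalAtlas (𝓡 n) ∞ N ∧
      IsCompact K ∧ K ⊆ φ.source ∧ MapsTo f K ψ.source ∧ 0 < ε ∧
      W = chartNhd r f φ ψ K ε}

/-- The strong (Whitney) topology on `C^∞(M, N)`: it is generated by the sets
`⋂ i, chartNhd r f (φ i) (ψ i) (K i) (ε i)` with `r` finite, `φ i` a family of smooth charts of `M`
with locally finite domains, `ψ i` a family of smooth charts of `N`, `K i` a compact subset of the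
domain of `φ i` which `f` maps into the domain of `ψ i`, and `ε i > 0`.
(A locally finite family of nonempty sets in a second countable space is countable, so that index
sets in `Type` suffice.) -/
@[reducible] def strongTopology (m n : ℕ) (M N : Type*)
    [TopologicalSpace M] [ChartedSpace (Euc m) M]
    [TopologicalSpace N] [ChartedSpace (Euc n) N] :
    TopologicalSpace C^∞⟮𝓡 m, M; 𝓡 n, N⟯ :=
  TopologicalSpace.generateFrom
    {W | ∃ (r : ℕ) (f : C^∞⟮𝓡 m, M; 𝓡 n, N⟯) (ι : Type)
        (φ : ι → OpenPartialHomeomorph M (Euc m)) (ψ : ι → OpenPartialHomeomorph N (Euc n))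
        (K : ι → Set M) (ε : ι → ℝ),
      LocallyFinite (fun i => (φ i).source) ∧
      (∀ i, φ i ∈ IsManifold.maximalAtlas (𝓡 m) ∞ M ∧
        ψ i ∈ IsManifold.maximalAtlas (𝓡 n) ∞ N ∧
        IsCompact (K i) ∧ K i ⊆ (φ i).source ∧ MapsTo f (K i) (ψ i).source ∧ 0 < ε i) ∧
      W = ⋂ i, chartNhd r f (φ i) (ψ i) (K i) (ε i)}

end FunctionSpaces

/-! ### Submanifolds, stratifications and `a`-regularity -/

section Stratifications

variable {n : ℕ} {N : Type*} [TopologicalSpace N] [ChartedSpace (Euc n) N]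

/-- `S` is a (smooth, embedded, not necessarily closed) submanifold of `N`: for some `k ≤ n`, around
each point of `S` there is a smooth chart of `N` in which `S` is given by the vanishing of the last
`n - k` coordinates. -/
def IsSubmanifold (n : ℕ) {N : Type*} [TopologicalSpace N]
    [ChartedSpace (Euc n) N] (S : Set N) : Prop :=
  ∃ k ≤ n, ∀ x ∈ S, ∃ ψ ∈ IsManifold.maximalAtlas (𝓡 n) ∞ N, x ∈ ψ.source ∧
    ∀ y ∈ ψ.source, y ∈ S ↔ ∀ i : Fin n, k ≤ (i : ℕ) → ψ y i = 0

/-- The tangent space `T_y S ⊆ T_y N` at a point `y` of a submanifold `S` of `N`: the velocities at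
time `0` of the smooth curves in `S` through `y`. (For a submanifold these velocities already form a
linear subspace; the span only makes the definition type-correct for arbitrary sets.) -/
def tangentSpaceOf (S : Set N) (y : N) : Submodule ℝ (TangentSpace (𝓡 n) y) :=
  Submodule.span ℝ {v | ∃ (γ : ℝ → N) (δ : ℝ), 0 < δ ∧ γ 0 = y ∧
    ContMDiffOn 𝓘(ℝ, ℝ) (𝓡 n) ∞ γ (Ioo (-δ) δ) ∧ (∀ t ∈ Ioo (-δ) δ, γ t ∈ S) ∧
    v = (mfderiv 𝓘(ℝ, ℝ) (𝓡 n) γ 0 (1 : ℝ) : Euc n)}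

/-- The image in `ℝⁿ` of a subspace of `T_y N` under the differential at `y` of the preferred chart
around `x` (meaningful for `y` in the domain of that chart). -/
def inChart (x : N) {y : N} (L : Submodule ℝ (TangentSpace (𝓡 n) y)) : Submodule ℝ (Euc n) :=
  Submodule.map (mfderiv (𝓡 n) (𝓡 n) (chartAt (Euc n) x) y).toLinearMap L

/-- For points `y i` converging to `x`: the subspaces `L i ⊆ T_{y i} N` converge to `τ ⊆ T_x N`.
Read in a chart around `x`, this is convergence in the Grassmannian of `ℝⁿ`, that is, convergence of
the orthogonal projections. -/
def TendstoSubspace {y : ℕ → N} (L : ∀ i, Submodule ℝ (TangentSpace (𝓡 n) (y i))) {x : N}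
    (τ : Submodule ℝ (TangentSpace (𝓡 n) x)) : Prop :=
  Tendsto (fun i => (inChart x (L i)).starProjection) atTop (𝓝 (inChart x τ).starProjection)

/-- `B` is `a`-regular over `A` at `x`: whenever points `y i` of `B` converge to `x` and the tangent
spaces `T_{y i} B` converge to `τ`, then `T_x A ⊆ τ`. -/
def IsARegularAt (n : ℕ) {N : Type*} [TopologicalSpace N]
    [ChartedSpace (Euc n) N] (A B : Set N) (x : N) : Prop :=
  ∀ y : ℕ → N, (∀ i, y i ∈ B) → Tendsto y atTop (𝓝 x) →
    ∀ τ : Submodule ℝ (TangentSpace (𝓡 n) x),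
      TendstoSubspace (fun i => tangentSpaceOf B (y i)) τ → tangentSpaceOf A x ≤ τ

/-- `𝒮` is a stratification of `V ⊆ N`: a locally finite partition of `V` into submanifolds of `N`
(the strata). -/
structure IsStratification (n : ℕ) {N : Type*} [TopologicalSpace N]
    [ChartedSpace (Euc n) N]
    (𝒮 : Set (Set N)) (V : Set N) : Prop where
  nonempty : ∀ A ∈ 𝒮, A.Nonempty
  disjoint : 𝒮.PairwiseDisjoint id
  sUnion_eq : ⋃₀ 𝒮 = V
  submanifold : ∀ A ∈ 𝒮, IsSubmanifold n A
  locallyFinite : ∀ x ∈ V, ∃ U ∈ 𝓝 x, {A ∈ 𝒮 | (A ∩ U).Nonempty}.Finite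

/-- A collection of strata is `a`-regular if for any two distinct strata `A`, `B`, the stratum `B` is
`a`-regular over `A` at every point of `A ∩ closure B`. -/
def IsARegular (n : ℕ) {N : Type*} [TopologicalSpace N]
    [ChartedSpace (Euc n) N]
    (𝒮 : Set (Set N)) : Prop :=
  𝒮.Pairwise fun A B => ∀ x ∈ A ∩ closure B, IsARegularAt n A B x

end Stratifications

/-! ### Transversality -/

section Transversality

variable {m n : ℕ} {M N : Type*}
  [TopologicalSpace M] [ChartedSpace (Euc m) M]
  [TopologicalSpace N] [ChartedSpace (Euc n) N]

/-- `f` is transverse to `S` at `x`: if `f x ∈ S`, then `T_{f x} S + Df_x (T_x M) = T_{f x} N`. -/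
def TransverseAt (f : C^∞⟮𝓡 m, M; 𝓡 n, N⟯) (S : Set N) (x : M) : Prop :=
  f x ∈ S → tangentSpaceOf S (f x) ⊔ (mfderiv (𝓡 m) (𝓡 n) f x).toLinearMap.range = ⊤

/-- The set of smooth maps that are transverse to every stratum of `𝒮` at every point of `K`. -/
def transverseMaps (m n : ℕ) {M N : Type*}
    [TopologicalSpace M] [ChartedSpace (Euc m) M]
    [TopologicalSpace N] [ChartedSpace (Euc n) N] (𝒮 : Set (Set N)) (K : Set M) :
    Set C^∞⟮𝓡 m, M; 𝓡 n, N⟯ :=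
  {f | ∀ x ∈ K, ∀ A ∈ 𝒮, TransverseAt f A x}

end Transversality

end StratTransverse

end

noncomputable section

namespace StratTransverse

/-! ### Tangent spaces of submanifolds and transversality, read in charts -/

/-! Openness rests on a statement about 1-jets (`eventually_transverse_strata`): near a pair (y₀,
L₀) that is transverse, all pairs (y, L) are transverse. Suppose pairs with y in a stratum B fail
and converge to (y₀, L₀). Orthogonal projections form a compact set, so after passing to a
subsequence the spaces T_yB converge to some K. By a-regularity, or by smoothness if B is the
stratum A of y₀, T_{y₀}A ⊆ K, so K and the range of L₀ span. Spanning survives small changes of both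
summands, a contradiction. A C¹-small chart neighbourhood controls the 1-jet. Finitely many such
neighbourhoods handle a compact K, a locally finite family a closed one.

For density, f is changed over a small compact set by adding, in charts, a cutoff times an affine
map t + Lx. The parameters (t, L) giving a non-transverse map are null (`measure_degenerateParams`).
This replaces Sard's theorem by a dimension count: failure of transversality makes one row of a
derivative depend on others, so the bad parameters form the differentiable image of part of a
hyperplane in a space of the same dimension. Countably many strata and charts keep the union null.

These local corrections are made successively along a locally finite compact cover. Openness
preserves the transversality already achieved, and compact support makes each correction small in
the strong topology (`tendsto_strongTopology_of_eq_off_compact`). The sequence is locally eventually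
constant, so its limit is smooth. The defining conditions of a basic strong neighbourhood live on
single compact sets, so they pass to the limit even when there are infinitely many of them. No Baire
argument is involved. -/

/-- The subspace of `ℝⁿ` given by the vanishing of the coordinates of index at least `k`. -/
def lastZero (n k : ℕ) : Submodule ℝ (Euc n) where
  carrier := {v | ∀ i : Fin n, k ≤ (i : ℕ) → v i = 0}
  add_mem' := fun ha hb i hi => by simp [ha i hi, hb i hi]
  zero_mem' := fun i _ => rfl
  smul_mem' := fun c v hv i hi => by simp [hv i hi]

section Charts

variable {m n : ℕ} {M N : Type*}
  [TopologicalSpace M] [ChartedSpace (Euc m) M]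
  [TopologicalSpace N] [ChartedSpace (Euc n) N]

/-- The tangent space of `A` at `y`, read in the chart `ψ`. -/
def chartTangent (ψ : OpenPartialHomeomorph N (Euc n)) (A : Set N) (y : N) :
    Submodule ℝ (Euc n) :=
  Submodule.map (mfderiv (𝓡 n) (𝓡 n) ψ y).toLinearMap (tangentSpaceOf A y)

theorem mdifferentiable_of_mem_maximalAtlas [IsManifold (𝓡 n) ∞ N]
    {ψ : OpenPartialHomeomorph N (Euc n)}
    (hψ : ψ ∈ IsManifold.maximalAtlas (𝓡 n) ∞ N) : ψ.MDifferentiable (𝓡 n) (𝓡 n) :=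
  ⟨(contMDiffOn_of_mem_maximalAtlas hψ).mdifferentiableOn (by simp),
    (contMDiffOn_symm_of_mem_maximalAtlas hψ).mdifferentiableOn (by simp)⟩

/-- In a chart flattening A, curves in A have constant zero last coordinates, hence so do their
velocities. Conversely, each vector of the flat model is the velocity of a straight segment pulled
back by the chart. -/
theorem chartTangent_eq_lastZero [IsManifold (𝓡 n) ∞ N]
    {ψ : OpenPartialHomeomorph N (Euc n)} (hψ : ψ ∈ IsManifold.maximalAtlas (𝓡 n) ∞ N)
    {A : Set N} {k : ℕ}
    (hA : ∀ y ∈ ψ.source, y ∈ A ↔ ∀ i : Fin n, k ≤ (i : ℕ) → ψ y i = 0)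
    {y : N} (hy : y ∈ ψ.source) (hyA : y ∈ A) : chartTangent ψ A y = lastZero n k := by
  have hψd := mdifferentiable_of_mem_maximalAtlas hψ
  apply le_antisymm
  · refine Submodule.map_le_iff_le_comap.2 (Submodule.span_le.2 ?_)
    rintro v ⟨γ, δ, hδ, hγ0, hγ, hγA, rfl⟩
    intro i hi
    have h0 : Ioo (-δ) δ ∈ 𝓝 (0 : ℝ) := Ioo_mem_nhds (by linarith) hδ
    have hγd : MDifferentiableAt 𝓘(ℝ, ℝ) (𝓡 n) γ 0 :=
      (hγ.contMDiffAt h0).mdifferentiableAt (by simp)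
    have hψγ : MDifferentiableAt (𝓡 n) (𝓡 n) ψ (γ 0) := hψd.mdifferentiableAt (hγ0 ▸ hy)
    have hcomp : mfderiv 𝓘(ℝ, ℝ) (𝓡 n) (ψ ∘ γ) 0
        = (mfderiv (𝓡 n) (𝓡 n) ψ (γ 0)).comp (mfderiv 𝓘(ℝ, ℝ) (𝓡 n) γ 0) :=
      mfderiv_comp (I' := 𝓡 n) 0 hψγ hγd
    have hd : DifferentiableAt ℝ (ψ ∘ γ) 0 :=
      (hψγ.comp (I' := 𝓡 n) 0 hγd).differentiableAt
    have e1 : (mfderiv (𝓡 n) (𝓡 n) ψ y) (mfderiv 𝓘(ℝ, ℝ) (𝓡 n) γ 0 (1 : ℝ) : Euc n)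
        = fderiv ℝ (ψ ∘ γ) 0 1 := by
      rw [← mfderiv_eq_fderiv]
      subst hγ0
      exact (congrArg (fun T => T (1 : ℝ)) hcomp).symm
    refine (congrArg (fun v : Euc n => v i) e1).trans ?_
    have hz : (fun t => (ψ ∘ γ) t i) =ᶠ[𝓝 0] fun _ => (0 : ℝ) := by
      have hs : ∀ᶠ t in 𝓝 (0 : ℝ), γ t ∈ ψ.source :=
        hγd.continuousAt.eventually_mem (ψ.open_source.mem_nhds (hγ0 ▸ hy))
      filter_upwards [h0, hs] with t ht hts
      exact (hA _ hts).1 (hγA t ht) i hi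
    have e2 : fderiv ℝ (fun t => (ψ ∘ γ) t i) 0 = (EuclideanSpace.proj i).comp
        (fderiv ℝ (ψ ∘ γ) 0) :=
      ((EuclideanSpace.proj (𝕜 := ℝ) i).hasFDerivAt.comp (0 : ℝ) hd.hasFDerivAt).fderiv
    rw [hz.fderiv_eq] at e2
    have := congrArg (fun T => T (1 : ℝ)) e2
    simpa using this.symm
  · intro w hw
    set γ : ℝ → N := fun t => ψ.symm (ψ y + t • w) with hγ
    have hc : Continuous fun t : ℝ => ψ y + t • w := by fun_prop
    have hO : (fun t : ℝ => ψ y + t • w) ⁻¹' ψ.target ∈ 𝓝 (0 : ℝ) :=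
      hc.continuousAt.preimage_mem_nhds
        (ψ.open_target.mem_nhds (by simpa using ψ.map_source hy))
    obtain ⟨δ, hδ, hsub⟩ := Metric.mem_nhds_iff.1 hO
    rw [Real.ball_eq_Ioo, zero_sub, zero_add] at hsub
    have hγ0 : γ 0 = y := by simp [hγ, hy]
    have hsm : ContMDiffOn 𝓘(ℝ, ℝ) (𝓡 n) ∞ γ (Ioo (-δ) δ) := by
      refine (contMDiffOn_symm_of_mem_maximalAtlas hψ).comp (t := ψ.target) ?_ hsub
      exact ContDiff.contMDiff (by fun_prop) |>.contMDiffOn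
    have h0 : Ioo (-δ) δ ∈ 𝓝 (0 : ℝ) := Ioo_mem_nhds (by linarith) hδ
    have hγd : MDifferentiableAt 𝓘(ℝ, ℝ) (𝓡 n) γ 0 :=
      (hsm.contMDiffAt h0).mdifferentiableAt (by simp)
    have hψγ : MDifferentiableAt (𝓡 n) (𝓡 n) ψ (γ 0) := hψd.mdifferentiableAt (hγ0 ▸ hy)
    have hcomp : mfderiv 𝓘(ℝ, ℝ) (𝓡 n) (ψ ∘ γ) 0
        = (mfderiv (𝓡 n) (𝓡 n) ψ (γ 0)).comp (mfderiv 𝓘(ℝ, ℝ) (𝓡 n) γ 0) :=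
      mfderiv_comp (I' := 𝓡 n) 0 hψγ hγd
    refine ⟨(mfderiv 𝓘(ℝ, ℝ) (𝓡 n) γ 0 (1 : ℝ) : Euc n), Submodule.subset_span
      ⟨γ, δ, hδ, hγ0, hsm, fun t ht => ?_, rfl⟩, ?_⟩
    · have ht' := hsub ht
      refine (hA _ (ψ.map_target ht')).2 fun i hi => ?_
      have h1 := (hA y hy).1 hyA i hi
      change ψ (ψ.symm (ψ y + t • w)) i = 0
      rw [ψ.right_inv ht']
      simp [h1, hw i hi]
    · have e1 : (mfderiv (𝓡 n) (𝓡 n) ψ y) (mfderiv 𝓘(ℝ, ℝ) (𝓡 n) γ 0 (1 : ℝ) : Euc n)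
          = fderiv ℝ (ψ ∘ γ) 0 1 := by
        rw [← mfderiv_eq_fderiv]
        clear_value γ
        subst hγ0
        exact (congrArg (fun T => T (1 : ℝ)) hcomp).symm
      refine e1.trans ?_
      have hev : ψ ∘ γ =ᶠ[𝓝 0] fun t : ℝ => ψ y + t • w := by
        filter_upwards [h0] with t ht
        exact ψ.right_inv (hsub ht)
      rw [hev.fderiv_eq]
      have : HasFDerivAt (fun t : ℝ => ψ y + t • w)
          ((ContinuousLinearMap.id ℝ ℝ).smulRight w) 0 :=
        ((hasFDerivAt_id (𝕜 := ℝ) (0 : ℝ)).smul_const w).const_add _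
      rw [this.fderiv]
      exact one_smul ℝ w

theorem contDiffAt_chart_comp_symm [IsManifold (𝓡 n) ∞ N]
    {ψ χ : OpenPartialHomeomorph N (Euc n)} (hψ : ψ ∈ IsManifold.maximalAtlas (𝓡 n) ∞ N)
    (hχ : χ ∈ IsManifold.maximalAtlas (𝓡 n) ∞ N) {z : Euc n} (hz : z ∈ χ.target)
    (hy : χ.symm z ∈ ψ.source) : ContDiffAt ℝ ∞ (ψ ∘ χ.symm) z :=
  (((contMDiffOn_of_mem_maximalAtlas hψ).contMDiffAt (ψ.open_source.mem_nhds hy)).comp z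
    ((contMDiffOn_symm_of_mem_maximalAtlas hχ).contMDiffAt (χ.open_target.mem_nhds hz))).contDiffAt

theorem contDiffAt_chart_comp [IsManifold (𝓡 m) ∞ M] [IsManifold (𝓡 n) ∞ N]
    {φ : OpenPartialHomeomorph M (Euc m)} (hφ : φ ∈ IsManifold.maximalAtlas (𝓡 m) ∞ M)
    {ψ : OpenPartialHomeomorph N (Euc n)} (hψ : ψ ∈ IsManifold.maximalAtlas (𝓡 n) ∞ N)
    (f : C^∞⟮𝓡 m, M; 𝓡 n, N⟯) {z : Euc m} (hz : z ∈ φ.target)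
    (hy : f (φ.symm z) ∈ ψ.source) : ContDiffAt ℝ ∞ (ψ ∘ f ∘ φ.symm) z :=
  (((contMDiffOn_of_mem_maximalAtlas hψ).contMDiffAt (ψ.open_source.mem_nhds hy)).comp z
    ((f.contMDiff _).comp z ((contMDiffOn_symm_of_mem_maximalAtlas hφ).contMDiffAt
      (φ.open_target.mem_nhds hz)))).contDiffAt

theorem fderiv_chart_comp [IsManifold (𝓡 m) ∞ M] [IsManifold (𝓡 n) ∞ N]
    {φ : OpenPartialHomeomorph M (Euc m)} (hφ : φ ∈ IsManifold.maximalAtlas (𝓡 m) ∞ M)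
    {ψ : OpenPartialHomeomorph N (Euc n)} (hψ : ψ ∈ IsManifold.maximalAtlas (𝓡 n) ∞ N)
    (f : C^∞⟮𝓡 m, M; 𝓡 n, N⟯) {x : M} (hx : x ∈ φ.source) (hy : f x ∈ ψ.source) :
    (fderiv ℝ (ψ ∘ f ∘ φ.symm) (φ x)).comp (mfderiv (𝓡 m) (𝓡 m) φ x)
      = (mfderiv (𝓡 n) (𝓡 n) ψ (f x)).comp (mfderiv (𝓡 m) (𝓡 n) f x) := by
  have hφd := mdifferentiable_of_mem_maximalAtlas hφ
  have hψd := mdifferentiable_of_mem_maximalAtlas hψ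
  have h1 : MDifferentiableAt (𝓡 m) (𝓡 n) (ψ ∘ f ∘ φ.symm) (φ x) :=
    ((contDiffAt_chart_comp hφ hψ f (φ.map_source hx)
      (by rwa [φ.left_inv hx])).differentiableAt (by simp)).mdifferentiableAt
  have h2 := mfderiv_comp (I' := 𝓡 m) x h1 (hφd.mdifferentiableAt hx)
  have h3 := mfderiv_comp (I' := 𝓡 n) x (hψd.mdifferentiableAt hy)
    ((f.contMDiff x).mdifferentiableAt (by simp))
  rw [← mfderiv_eq_fderiv]
  refine h2.symm.trans (Eq.trans ?_ h3)
  apply Filter.EventuallyEq.mfderiv_eq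
  filter_upwards [φ.open_source.mem_nhds hx] with z hz
  simp [φ.left_inv hz]

theorem fderiv_chart_change [IsManifold (𝓡 n) ∞ N]
    {ψ χ : OpenPartialHomeomorph N (Euc n)} (hψ : ψ ∈ IsManifold.maximalAtlas (𝓡 n) ∞ N)
    (hχ : χ ∈ IsManifold.maximalAtlas (𝓡 n) ∞ N) {y : N} (hyψ : y ∈ ψ.source)
    (hyχ : y ∈ χ.source) :
    (fderiv ℝ (ψ ∘ χ.symm) (χ y)).comp (mfderiv (𝓡 n) (𝓡 n) χ y) = mfderiv (𝓡 n) (𝓡 n) ψ y := by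
  have := fderiv_chart_comp hχ hψ (ContMDiffMap.id : C^∞⟮𝓡 n, N; 𝓡 n, N⟯) hyχ hyψ
  refine this.trans ?_
  have h : mfderiv (𝓡 n) (𝓡 n) (ContMDiffMap.id : C^∞⟮𝓡 n, N; 𝓡 n, N⟯) y
    = ContinuousLinearMap.id ℝ _ := mfderiv_id
  rw [h]
  rfl

theorem map_chartTangent [IsManifold (𝓡 n) ∞ N]
    {ψ χ : OpenPartialHomeomorph N (Euc n)} (hψ : ψ ∈ IsManifold.maximalAtlas (𝓡 n) ∞ N)
    (hχ : χ ∈ IsManifold.maximalAtlas (𝓡 n) ∞ N) (A : Set N) {y : N} (hyψ : y ∈ ψ.source)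
    (hyχ : y ∈ χ.source) :
    (chartTangent χ A y).map (fderiv ℝ (ψ ∘ χ.symm) (χ y)).toLinearMap = chartTangent ψ A y := by
  rw [chartTangent, chartTangent, ← fderiv_chart_change hψ hχ hyψ hyχ]
  exact (Submodule.map_comp _ _ _).symm

theorem sup_range_eq_top_iff [IsManifold (𝓡 m) ∞ M] [IsManifold (𝓡 n) ∞ N]
    {φ : OpenPartialHomeomorph M (Euc m)} (hφ : φ ∈ IsManifold.maximalAtlas (𝓡 m) ∞ M)
    {ψ : OpenPartialHomeomorph N (Euc n)} (hψ : ψ ∈ IsManifold.maximalAtlas (𝓡 n) ∞ N)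
    (f : C^∞⟮𝓡 m, M; 𝓡 n, N⟯) (A : Set N) {x : M} (hx : x ∈ φ.source) (hy : f x ∈ ψ.source) :
    tangentSpaceOf A (f x) ⊔ (mfderiv (𝓡 m) (𝓡 n) f x).toLinearMap.range = ⊤ ↔
      chartTangent ψ A (f x) ⊔ (fderiv ℝ (ψ ∘ f ∘ φ.symm) (φ x)).toLinearMap.range = ⊤ := by
  have hφs := (mdifferentiable_of_mem_maximalAtlas hφ).mfderiv_surjective hx
  have hψb := (mdifferentiable_of_mem_maximalAtlas hψ).mfderiv_bijective hy
  have h1 : (fderiv ℝ (ψ ∘ f ∘ φ.symm) (φ x)).toLinearMap.range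
      = (mfderiv (𝓡 m) (𝓡 n) f x).toLinearMap.range.map
        (mfderiv (𝓡 n) (𝓡 n) ψ (f x)).toLinearMap := by
    rw [← LinearMap.range_comp]
    have h2 := congrArg ContinuousLinearMap.toLinearMap (fderiv_chart_comp hφ hψ f hx hy)
    refine Eq.trans ?_ (congrArg LinearMap.range h2)
    exact (LinearMap.range_comp_of_range_eq_top (f := (mfderiv (𝓡 m) (𝓡 m) φ x).toLinearMap)
      (fderiv ℝ (ψ ∘ f ∘ φ.symm) (φ x)).toLinearMap (LinearMap.range_eq_top.2 hφs)).symm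
  rw [h1, chartTangent]
  constructor
  · intro h
    refine (Submodule.map_sup _ _ _).symm.trans ?_
    rw [h]
    exact (Submodule.map_top _).trans (LinearMap.range_eq_top.2 hψb.2)
  · intro h
    apply Submodule.map_injective_of_injective (f := (mfderiv (𝓡 n) (𝓡 n) ψ (f x)).toLinearMap)
      hψb.1
    refine (Submodule.map_sup _ _ _).trans (Eq.trans h ?_)
    exact ((Submodule.map_top _).trans (LinearMap.range_eq_top.2 hψb.2)).symm

end Charts

/-! ### Transversality to an `a`-regular stratification is an open condition on `1`-jets -/

/-! ### Limits of subspaces and stability of spanning -/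

section LinearAlgebra

variable {E F : Type*} [NormedAddCommGroup E] [InnerProductSpace ℝ E] [FiniteDimensional ℝ E]
  [NormedAddCommGroup F] [NormedSpace ℝ F]

/-- Compactness of the Grassmannian: projections lie in the unit ball of operators, and being
idempotent and self-adjoint is a closed condition, so a limit of projections is again one. -/
theorem exists_subseq_tendsto_starProjection (K : ℕ → Submodule ℝ E) :
    ∃ (K' : Submodule ℝ E) (θ : ℕ → ℕ), StrictMono θ ∧
      Tendsto (fun i => (K (θ i)).starProjection) atTop (𝓝 K'.starProjection) := by
  have : ProperSpace (E →L[ℝ] E) := FiniteDimensional.proper ℝ _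
  obtain ⟨P, -, θ, hθ, hP⟩ := (isCompact_closedBall (0 : E →L[ℝ] E) 1).tendsto_subseq
    (x := fun i => (K i).starProjection)
    (fun i => by simpa using (K i).starProjection_norm_le)
  have hstar : IsStarProjection P := by
    refine ⟨?_, ?_⟩
    · have h2 := hP.mul hP
      refine tendsto_nhds_unique h2 (hP.congr fun i => ?_)
      exact ((K (θ i)).isIdempotentElem_starProjection).symm
    · have h2 := hP.star
      refine tendsto_nhds_unique h2 (hP.congr fun i => ?_)
      exact (isSelfAdjoint_starProjection (K (θ i))).symm
  obtain ⟨_, h⟩ := isStarProjection_iff_eq_starProjection_range.1 hstar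
  refine ⟨P.range, θ, hθ, ?_⟩
  rw [← h]
  exact hP

/-- Spanning means that (v, w) ↦ P v + L w is surjective, P being the projection onto the subspace.
Composing the nearby maps with a fixed right inverse of the limit map gives operators tending to 1,
hence eventually invertible. -/
theorem eventually_sup_range_eq_top {ι : Type*} {l : Filter ι} {K : ι → Submodule ℝ E}
    {K' : Submodule ℝ E} {L : ι → F →L[ℝ] E} {L' : F →L[ℝ] E}
    (hK : Tendsto (fun i => (K i).starProjection) l (𝓝 K'.starProjection))
    (hL : Tendsto L l (𝓝 L')) (h : K' ⊔ L'.toLinearMap.range = ⊤) :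
    ∀ᶠ i in l, K i ⊔ (L i).toLinearMap.range = ⊤ := by
  have hsurj : Function.Surjective (K'.starProjection.coprod L').toLinearMap := by
    rw [← LinearMap.range_eq_top, eq_top_iff, ← h]
    refine sup_le (fun v hv => ⟨(v, 0), ?_⟩) ?_
    · simpa using (Submodule.starProjection_eq_self_iff.2 hv)
    · rintro _ ⟨w, rfl⟩
      exact ⟨(0, w), by simp⟩
  obtain ⟨R, hR⟩ := LinearMap.exists_rightInverse_of_surjective _ (LinearMap.range_eq_top.2 hsurj)
  set R1 : E →L[ℝ] E := (LinearMap.fst ℝ E F ∘ₗ R).toContinuousLinearMap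
  set R2 : E →L[ℝ] F := (LinearMap.snd ℝ E F ∘ₗ R).toContinuousLinearMap
  have hlim : Tendsto (fun i => (K i).starProjection.comp R1 + (L i).comp R2) l
      (𝓝 (K'.starProjection.comp R1 + L'.comp R2)) :=
    (((isBoundedBilinearMap_comp (𝕜 := ℝ)).continuous.tendsto (_, _)).comp
        (hK.prodMk_nhds tendsto_const_nhds)).add
      (((isBoundedBilinearMap_comp (𝕜 := ℝ)).continuous.tendsto (_, _)).comp
        (hL.prodMk_nhds tendsto_const_nhds))
  have hone : K'.starProjection.comp R1 + L'.comp R2 = 1 := by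
    ext v
    simpa [R1, R2] using LinearMap.congr_fun hR v
  rw [hone] at hlim
  filter_upwards [hlim.eventually_mem (Units.isOpen.mem_nhds isUnit_one)] with i hi
  rw [eq_top_iff]
  intro v _
  obtain ⟨u, rfl⟩ := (ContinuousLinearMap.isUnit_iff_bijective.1 hi).2 v
  exact Submodule.add_mem_sup (Submodule.starProjection_apply_mem _ _) ⟨_, rfl⟩

end LinearAlgebra

/-! ### Stability of transversality near one point -/

section Strata

variable {m n : ℕ} {M N : Type*}
  [TopologicalSpace M] [ChartedSpace (Euc m) M]
  [TopologicalSpace N] [ChartedSpace (Euc n) N] [IsManifold (𝓡 n) ∞ N]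

/-- The case of a single stratum, where no regularity is needed: a fixed vector of the flat model is
transported to tangent vectors at all nearby points of A. These are fixed by the projections, so
their limit is fixed by the limiting projection. -/
theorem chartTangent_le_of_tendsto {A : Set N} (hA : IsSubmanifold n A)
    {χ : OpenPartialHomeomorph N (Euc n)} (hχ : χ ∈ IsManifold.maximalAtlas (𝓡 n) ∞ N)
    {y : ℕ → N} {y₀ : N} (hyA : ∀ i, y i ∈ A) (hy₀ : y₀ ∈ A) (hy₀χ : y₀ ∈ χ.source)
    (hy : Tendsto y atTop (𝓝 y₀)) {K : Submodule ℝ (Euc n)}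
    (hK : Tendsto (fun i => (chartTangent χ A (y i)).starProjection) atTop
      (𝓝 K.starProjection)) : chartTangent χ A y₀ ≤ K := by
  obtain ⟨k, -, hk⟩ := hA
  obtain ⟨ψ, hψ, hy₀ψ, hψA⟩ := hk y₀ hy₀
  rw [← map_chartTangent hχ hψ A hy₀χ hy₀ψ, chartTangent_eq_lastZero hψ hψA hy₀ψ hy₀]
  rintro _ ⟨u, hu, rfl⟩
  have hcd : ContDiffAt ℝ ∞ (χ ∘ ψ.symm) (ψ y₀) :=
    contDiffAt_chart_comp_symm hχ hψ (ψ.map_source hy₀ψ) (by rwa [ψ.left_inv hy₀ψ])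
  have h1 : Tendsto (fun i => fderiv ℝ (χ ∘ ψ.symm) (ψ (y i)) u) atTop
      (𝓝 (fderiv ℝ (χ ∘ ψ.symm) (ψ y₀) u)) := by
    have h2 := ((hcd.fderiv_right (m := 0) (by simp)).continuousAt.tendsto.comp
      ((ψ.continuousAt hy₀ψ).tendsto.comp hy))
    exact (isBoundedBilinearMap_apply.continuous.tendsto (_, u)).comp
      (h2.prodMk_nhds tendsto_const_nhds)
  have h3 := (isBoundedBilinearMap_apply.continuous.tendsto (_, _)).comp (hK.prodMk_nhds h1)
  have h4 : ∀ᶠ i in atTop, (chartTangent χ A (y i)).starProjection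
      (fderiv ℝ (χ ∘ ψ.symm) (ψ (y i)) u) = fderiv ℝ (χ ∘ ψ.symm) (ψ (y i)) u := by
    filter_upwards [hy.eventually_mem (ψ.open_source.mem_nhds hy₀ψ),
      hy.eventually_mem (χ.open_source.mem_nhds hy₀χ)] with i h5 h6
    rw [Submodule.starProjection_eq_self_iff, ← map_chartTangent hχ hψ A h6 h5,
      chartTangent_eq_lastZero hψ hψA h5 (hyA i)]
    exact ⟨u, hu, rfl⟩
  exact Submodule.starProjection_eq_self_iff.1
    (tendsto_nhds_unique h3 (h1.congr' (h4.mono fun _ h => h.symm)))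

theorem eventually_transverse_stratum [FirstCountableTopology N] {A B : Set N} {y₀ : N}
    (hA : IsSubmanifold n A) (hy₀ : y₀ ∈ A)
    (hAB : A ≠ B → y₀ ∈ closure B → IsARegularAt n A B y₀)
    {L₀ : Euc m →L[ℝ] Euc n}
    (h₀ : chartTangent (chartAt (Euc n) y₀) A y₀ ⊔ L₀.toLinearMap.range = ⊤) :
    ∀ᶠ p : N × (Euc m →L[ℝ] Euc n) in 𝓝 (y₀, L₀),
      p.1 ∈ B → chartTangent (chartAt (Euc n) y₀) B p.1 ⊔ p.2.toLinearMap.range = ⊤ := by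
  by_contra hcon
  obtain ⟨p, hp, hpB⟩ := exists_seq_forall_of_frequently (not_eventually.1 hcon)
  have hχ : chartAt (Euc n) y₀ ∈ IsManifold.maximalAtlas (𝓡 n) ∞ N :=
    IsManifold.chart_mem_maximalAtlas y₀
  obtain ⟨K, θ, hθ, hK⟩ := exists_subseq_tendsto_starProjection
    fun i => chartTangent (chartAt (Euc n) y₀) B (p i).1
  have hpθ := hp.comp hθ.tendsto_atTop
  rw [nhds_prod_eq] at hpθ
  have hy : Tendsto (fun i => (p (θ i)).1) atTop (𝓝 y₀) := tendsto_fst.comp hpθ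
  have hL : Tendsto (fun i => (p (θ i)).2) atTop (𝓝 L₀) := tendsto_snd.comp hpθ
  have hyB : ∀ i, (p (θ i)).1 ∈ B := fun i => by
    have := hpB (θ i)
    push Not at this
    exact this.1
  have hle : chartTangent (chartAt (Euc n) y₀) A y₀ ≤ K := by
    by_cases hEq : A = B
    · subst hEq
      exact chartTangent_le_of_tendsto hA hχ hyB hy₀ (mem_chart_source _ y₀) hy hK
    · have hcl : y₀ ∈ closure B := mem_closure_of_tendsto hy (Eventually.of_forall hyB)
      have hs := (mdifferentiable_of_mem_maximalAtlas hχ).mfderiv_surjective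
        (mem_chart_source (Euc n) y₀)
      -- The limit K lives in the chart; a-regularity speaks of a subspace of the tangent space at
      -- `y₀`, so K is pulled back by the differential of the chart, which is onto.
      set τ : Submodule ℝ (TangentSpace (𝓡 n) y₀) :=
        K.comap (mfderiv (𝓡 n) (𝓡 n) (chartAt (Euc n) y₀) y₀).toLinearMap with hτ
      have hτK : inChart y₀ τ = K := Submodule.map_comap_eq_of_surjective hs K
      have := hAB hEq hcl (fun i => (p (θ i)).1) hyB hy τ
        (show Tendsto _ _ (𝓝 (inChart y₀ τ).starProjection) by rw [hτK]; exact hK)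
      exact Submodule.map_le_iff_le_comap.2 this
  have htop : K ⊔ L₀.toLinearMap.range = ⊤ := eq_top_iff.2 (h₀ ▸ sup_le_sup_right hle _)
  obtain ⟨i, hi⟩ := (eventually_sup_range_eq_top hK hL htop).exists
  exact hpB (θ i) fun _ => hi

theorem eventually_transverse_strata [FirstCountableTopology N] {𝒮 : Set (Set N)} {S : Set N}
    (hS : IsClosed S) (h𝒮 : IsStratification n 𝒮 S) (hreg : IsARegular n 𝒮) (y₀ : N)
    {L₀ : Euc m →L[ℝ] Euc n}
    (h₀ : ∀ A ∈ 𝒮, y₀ ∈ A →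
      chartTangent (chartAt (Euc n) y₀) A y₀ ⊔ L₀.toLinearMap.range = ⊤) :
    ∀ᶠ p : N × (Euc m →L[ℝ] Euc n) in 𝓝 (y₀, L₀), ∀ B ∈ 𝒮,
      p.1 ∈ B → chartTangent (chartAt (Euc n) y₀) B p.1 ⊔ p.2.toLinearMap.range = ⊤ := by
  -- On S, local finiteness leaves finitely many strata to consider; off S, closedness of S leaves
  -- none.
  by_cases hy : y₀ ∈ S
  · obtain ⟨A, hA, hyA⟩ : ∃ A ∈ 𝒮, y₀ ∈ A := by
      rw [← h𝒮.sUnion_eq] at hy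
      exact hy
    obtain ⟨U, hU, hfin⟩ := h𝒮.locallyFinite y₀ hy
    have h1 := (Set.Finite.eventually_all hfin).2 fun B hB =>
      eventually_transverse_stratum (B := B) (h𝒮.submanifold A hA) hyA
        (fun hne hcl => hreg hA hB.1 hne y₀ ⟨hyA, hcl⟩) (h₀ A hA hyA)
    have h2 : ∀ᶠ p : N × (Euc m →L[ℝ] Euc n) in 𝓝 (y₀, L₀), p.1 ∈ U :=
      continuous_fst.continuousAt.eventually_mem hU
    filter_upwards [h1, h2] with p hp hpU B hB hpB
    exact hp B ⟨hB, p.1, hpB, hpU⟩ hpB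
  · have h2 : ∀ᶠ p : N × (Euc m →L[ℝ] Euc n) in 𝓝 (y₀, L₀), p.1 ∈ Sᶜ :=
      continuous_fst.continuousAt.eventually_mem (hS.isOpen_compl.mem_nhds hy)
    filter_upwards [h2] with p hp B hB hpB
    exact absurd (h𝒮.sUnion_eq ▸ mem_sUnion_of_mem hpB hB) hp

theorem norm_fderiv_sub_le {E F : Type*} [NormedAddCommGroup E] [NormedSpace ℝ E]
    [NormedAddCommGroup F] [NormedSpace ℝ F] (f g : E → F) (x : E) :
    ‖fderiv ℝ f x - fderiv ℝ g x‖ ≤ ‖iteratedFDeriv ℝ 1 f x - iteratedFDeriv ℝ 1 g x‖ := by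
  refine ContinuousLinearMap.opNorm_le_bound _ (norm_nonneg _) fun v => ?_
  have := (iteratedFDeriv ℝ 1 f x - iteratedFDeriv ℝ 1 g x).le_opNorm fun _ => v
  simpa using this

variable [IsManifold (𝓡 m) ∞ M]

theorem exists_chartNhd_subset_transverseMaps [FirstCountableTopology N] {𝒮 : Set (Set N)}
    {S : Set N} (hS : IsClosed S) (h𝒮 : IsStratification n 𝒮 S) (hreg : IsARegular n 𝒮)
    (f : C^∞⟮𝓡 m, M; 𝓡 n, N⟯) (x : M) (hf : ∀ A ∈ 𝒮, TransverseAt f A x) :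
    ∃ V : Set M, IsOpen V ∧ x ∈ V ∧ V ⊆ (chartAt (Euc m) x).source ∧
      MapsTo f V (chartAt (Euc n) (f x)).source ∧ ∃ ε > 0, ∀ C ⊆ V,
        chartNhd 1 f (chartAt (Euc m) x) (chartAt (Euc n) (f x)) C ε ⊆
          transverseMaps m n 𝒮 C := by
  set φ := chartAt (Euc m) x
  set ψ := chartAt (Euc n) (f x)
  have hφ : φ ∈ IsManifold.maximalAtlas (𝓡 m) ∞ M := IsManifold.chart_mem_maximalAtlas x
  have hψ : ψ ∈ IsManifold.maximalAtlas (𝓡 n) ∞ N := IsManifold.chart_mem_maximalAtlas (f x)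
  have hxφ : x ∈ φ.source := mem_chart_source _ x
  have hfψ : f x ∈ ψ.source := mem_chart_source _ (f x)
  set L₀ := fderiv ℝ (ψ ∘ f ∘ φ.symm) (φ x)
  have h1 := eventually_transverse_strata hS h𝒮 hreg (f x) (L₀ := L₀)
    fun A hA hxA => (sup_range_eq_top_iff hφ hψ f A hxφ hfψ).1 (hf A hA hxA)
  -- The base point is moved from N to its chart image, so that neighbourhoods of the 1-jet become
  -- metric balls.
  have hc : ContinuousAt (fun q : Euc n × (Euc m →L[ℝ] Euc n) => (ψ.symm q.1, q.2))
      (ψ (f x), L₀) := by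
    refine ContinuousAt.prodMk ?_ continuousAt_snd
    exact ContinuousAt.comp (f := Prod.fst) (g := ψ.symm)
      (ψ.continuousAt_symm (ψ.map_source hfψ)) continuousAt_fst
  have h2 := hc.eventually (p := fun p : N × (Euc m →L[ℝ] Euc n) => ∀ B ∈ 𝒮,
      p.1 ∈ B → chartTangent ψ B p.1 ⊔ p.2.toLinearMap.range = ⊤)
      (by simpa only [ψ.left_inv hfψ] using h1)
  obtain ⟨δ, hδ, hball⟩ := Metric.eventually_nhds_iff.1 h2
  have hcf : ContinuousAt (fun x' => ψ (f x')) x :=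
    ContinuousAt.comp (g := ψ) (ψ.continuousAt hfψ) f.contMDiff.continuous.continuousAt
  have hcd : ContinuousAt (fun x' => fderiv ℝ (ψ ∘ f ∘ φ.symm) (φ x')) x := by
    have h3 : ContDiffAt ℝ ∞ (ψ ∘ f ∘ φ.symm) (φ x) :=
      contDiffAt_chart_comp hφ hψ f (φ.map_source hxφ) (by rwa [φ.left_inv hxφ])
    exact ContinuousAt.comp (g := fderiv ℝ (ψ ∘ f ∘ φ.symm))
      (h3.fderiv_right (m := 0) (by simp)).continuousAt (φ.continuousAt hxφ)
  -- Half of `δ` allows for the variation of the 1-jet of f over V; the other half, taken as the ε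
  -- of the chart neighbourhood, bounds the distance from f to g.
  have hV : ∀ᶠ x' in 𝓝 x, x' ∈ φ.source ∧ f x' ∈ ψ.source ∧
      dist (ψ (f x')) (ψ (f x)) < δ / 2 ∧
      dist (fderiv ℝ (ψ ∘ f ∘ φ.symm) (φ x')) L₀ < δ / 2 :=
    (φ.open_source.eventually_mem hxφ).and <|
      (f.contMDiff.continuous.continuousAt.eventually_mem (ψ.open_source.mem_nhds hfψ)).and <|
      (Metric.continuousAt_iff'.1 hcf _ (half_pos hδ)).and
        (Metric.continuousAt_iff'.1 hcd _ (half_pos hδ))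
  obtain ⟨V, hVs, hVo, hxV⟩ := eventually_nhds_iff.1 hV
  refine ⟨V, hVo, hxV, fun x' hx' => (hVs x' hx').1, fun x' hx' => (hVs x' hx').2.1,
    δ / 2, half_pos hδ, fun C hC g hg x' hx' A hA hgA => ?_⟩
  obtain ⟨hx'φ, -, hd0, hd1⟩ := hVs x' (hC hx')
  have hgψ : g x' ∈ ψ.source := hg.1 hx'
  have h0 := hg.2 (φ x') (mem_image_of_mem _ hx') 0 (by simp)
  have h1 := hg.2 (φ x') (mem_image_of_mem _ hx') 1 le_rfl
  have h0' : dist (ψ (g x')) (ψ (f x')) < δ / 2 := by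
    refine lt_of_le_of_lt ?_ h0
    rw [dist_comm, dist_eq_norm]
    have := (iteratedFDeriv ℝ 0 (ψ ∘ f ∘ φ.symm) (φ x')
      - iteratedFDeriv ℝ 0 (ψ ∘ g ∘ φ.symm) (φ x')).le_opNorm (fun _ => 0)
    simpa [φ.left_inv hx'φ] using this
  have h1' : dist (fderiv ℝ (ψ ∘ g ∘ φ.symm) (φ x')) (fderiv ℝ (ψ ∘ f ∘ φ.symm) (φ x'))
      < δ / 2 := by
    rw [dist_comm, dist_eq_norm]
    exact lt_of_le_of_lt (norm_fderiv_sub_le _ _ _) h1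
  have hmem : dist (ψ (g x'), fderiv ℝ (ψ ∘ g ∘ φ.symm) (φ x')) (ψ (f x), L₀) < δ := by
    rw [Prod.dist_eq]
    refine max_lt ?_ ?_
    · have := dist_triangle (ψ (g x')) (ψ (f x')) (ψ (f x))
      linarith
    · have := dist_triangle (fderiv ℝ (ψ ∘ g ∘ φ.symm) (φ x'))
        (fderiv ℝ (ψ ∘ f ∘ φ.symm) (φ x')) L₀
      linarith
  have hfin := hball hmem A hA
  simp only [ψ.left_inv hgψ] at hfin
  exact (sup_range_eq_top_iff hφ hψ g A hx'φ hgψ).2 (hfin hgA)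

end Strata

/-! ### Openness of transversality -/

/-- Paracompactness gives a locally finite refinement with relatively compact members, and the
shrinking lemma gives closed, hence compact, sets inside them that still cover. Indexing by ℕ serves
the later induction; unused indices carry empty sets. -/
theorem exists_locallyFinite_compact_cover {X : Type*} [TopologicalSpace X] [T2Space X]
    [SecondCountableTopology X] [LocallyCompactSpace X] [Nonempty X] (V : X → Set X)
    (hV : ∀ x, V x ∈ 𝓝 x) :
    ∃ (c : ℕ → X) (U C : ℕ → Set X), (∀ j, IsOpen (U j)) ∧ (∀ j, IsCompact (C j)) ∧
      (∀ j, C j ⊆ U j) ∧ (∀ j, U j ⊆ V (c j)) ∧ LocallyFinite U ∧ ⋃ j, C j = univ := by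
  have hB : ∀ x : X, (𝓝 x).HasBasis
      (fun t : Set X => (x ∈ t ∧ IsOpen t) ∧ IsCompact (closure t) ∧ t ⊆ V x) id := by
    intro x
    refine hasBasis_iff.2 fun t => ⟨fun ht => ?_, ?_⟩
    · obtain ⟨K, hKc, hxK, hK⟩ := exists_compact_subset isOpen_interior
        (mem_interior_iff_mem_nhds.2 (inter_mem ht (hV x)))
      have hK' := hK.trans interior_subset
      exact ⟨interior K, ⟨⟨hxK, isOpen_interior⟩,
        hKc.of_isClosed_subset isClosed_closure (closure_minimal interior_subset hKc.isClosed),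
        fun y hy => (hK' (interior_subset hy)).2⟩, fun y hy => (hK' (interior_subset hy)).1⟩
    · rintro ⟨s, ⟨⟨hxs, hso⟩, -⟩, hst⟩
      exact mem_of_superset (hso.mem_nhds hxs) hst
  obtain ⟨α, c, r, hr, hcov, hfin⟩ :=
    refinement_of_locallyCompact_sigmaCompact_of_nhds_basis hB
  obtain ⟨v, hv, hvc, hvr⟩ := exists_subset_iUnion_closed_subset isClosed_univ
    (fun a => (hr a).1.2) (fun x _ => hfin.point_finite x) hcov.ge
  have hcount : Countable α := countable_univ_iff.1
    (hfin.countable_univ fun a => ⟨c a, (hr a).1.1⟩)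
  obtain ⟨e, he⟩ := exists_injective_nat α
  obtain ⟨x₀⟩ := ‹Nonempty X›
  have key : ∀ j, (∃ a, e a = j) ∨ ∀ a, e a ≠ j := fun j => by
    by_cases h : ∃ a, e a = j
    · exact Or.inl h
    · exact Or.inr (not_exists.1 h)
  have hno : ∀ {β : Type _} (F : α → β) (d : β) (j : ℕ), (∀ a, e a ≠ j) →
      Function.extend e F (fun _ => d) j = d := fun F d j hj =>
    Function.extend_apply' _ _ _ (not_exists.2 hj)
  refine ⟨Function.extend e c fun _ => x₀, Function.extend e (fun a => id (r a)) fun _ => ∅,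
    Function.extend e v fun _ => ∅, fun j => ?_, fun j => ?_, fun j => ?_, fun j => ?_, ?_, ?_⟩
  · rcases key j with ⟨a, rfl⟩ | hj
    · rw [he.extend_apply]
      exact (hr a).1.2
    · rw [hno _ _ _ hj]
      exact isOpen_empty
  · rcases key j with ⟨a, rfl⟩ | hj
    · rw [he.extend_apply]
      exact (hr a).2.1.of_isClosed_subset (hvc a) ((hvr a).trans subset_closure)
    · rw [hno _ _ _ hj]
      exact isCompact_empty
  · rcases key j with ⟨a, rfl⟩ | hj
    · rw [he.extend_apply, he.extend_apply]
      exact hvr a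
    · rw [hno _ _ _ hj]
      exact empty_subset _
  · rcases key j with ⟨a, rfl⟩ | hj
    · rw [he.extend_apply, he.extend_apply]
      exact (hr a).2.2
    · rw [hno _ _ _ hj]
      exact empty_subset _
  · intro x
    obtain ⟨t, ht, hft⟩ := hfin x
    refine ⟨t, ht, (hft.image e).subset ?_⟩
    rintro j ⟨y, hy, hyt⟩
    rcases key j with ⟨a, rfl⟩ | hj
    · rw [he.extend_apply] at hy
      exact ⟨a, ⟨y, hy, hyt⟩, rfl⟩
    · rw [hno _ _ _ hj] at hy
      exact hy.elim
  · refine eq_univ_of_forall fun x => ?_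
    obtain ⟨a, ha⟩ := mem_iUnion.1 (hv (mem_univ x))
    exact mem_iUnion.2 ⟨e a, by rwa [he.extend_apply]⟩

section Open

variable {m n : ℕ} {M N : Type*}
  [TopologicalSpace M] [ChartedSpace (Euc m) M]
  [TopologicalSpace N] [ChartedSpace (Euc n) N]

theorem self_mem_chartNhd {r : ℕ} {f : C^∞⟮𝓡 m, M; 𝓡 n, N⟯}
    {φ : OpenPartialHomeomorph M (Euc m)} {ψ : OpenPartialHomeomorph N (Euc n)} {K : Set M}
    {ε : ℝ} (hK : MapsTo f K ψ.source) (hε : 0 < ε) : f ∈ chartNhd r f φ ψ K ε :=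
  ⟨hK, fun y _ k _ => by simpa using hε⟩

theorem isOpen_weakTopology_chartNhd {r : ℕ} {f : C^∞⟮𝓡 m, M; 𝓡 n, N⟯}
    {φ : OpenPartialHomeomorph M (Euc m)} {ψ : OpenPartialHomeomorph N (Euc n)} {K : Set M}
    {ε : ℝ} (hφ : φ ∈ IsManifold.maximalAtlas (𝓡 m) ∞ M)
    (hψ : ψ ∈ IsManifold.maximalAtlas (𝓡 n) ∞ N) (hK : IsCompact K) (hKφ : K ⊆ φ.source)
    (hKψ : MapsTo f K ψ.source) (hε : 0 < ε) :
    IsOpen[weakTopology m n M N] (chartNhd r f φ ψ K ε) :=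
  TopologicalSpace.isOpen_generateFrom_of_mem ⟨r, f, φ, ψ, K, ε, hφ, hψ, hK, hKφ, hKψ, hε, rfl⟩

theorem strongTopology_le_weakTopology : strongTopology m n M N ≤ weakTopology m n M N := by
  refine le_generateFrom ?_
  rintro W ⟨r, f, φ, ψ, K, ε, hφ, hψ, hK, hKφ, hKψ, hε, rfl⟩
  refine TopologicalSpace.isOpen_generateFrom_of_mem ⟨r, f, Unit, fun _ => φ, fun _ => ψ,
    fun _ => K, fun _ => ε, locallyFinite_of_finite _,
    fun _ => ⟨hφ, hψ, hK, hKφ, hKψ, hε⟩, ?_⟩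
  exact (iInter_const _).symm

variable [IsManifold (𝓡 m) ∞ M] [IsManifold (𝓡 n) ∞ N] [FirstCountableTopology N]
  {𝒮 : Set (Set N)} {S : Set N}

/-- Away from K a neighbourhood missing K suffices, with an arbitrary ε. Having neighbourhoods at
all points of M lets a cover of M be used in the strong case. -/
theorem exists_chartNhd_subset_transverseMaps_inter (hS : IsClosed S)
    (h𝒮 : IsStratification n 𝒮 S) (hreg : IsARegular n 𝒮) {K : Set M} (hK : IsClosed K)
    {f : C^∞⟮𝓡 m, M; 𝓡 n, N⟯} (hf : f ∈ transverseMaps m n 𝒮 K) (x : M) :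
    ∃ V ∈ 𝓝 x, V ⊆ (chartAt (Euc m) x).source ∧
      MapsTo f V (chartAt (Euc n) (f x)).source ∧ ∃ ε > 0, ∀ C ⊆ V,
        chartNhd 1 f (chartAt (Euc m) x) (chartAt (Euc n) (f x)) C ε ⊆
          transverseMaps m n 𝒮 (C ∩ K) := by
  by_cases hx : x ∈ K
  · obtain ⟨V, hVo, hxV, hVφ, hVψ, ε, hε, hV⟩ :=
      exists_chartNhd_subset_transverseMaps hS h𝒮 hreg f x (hf x hx)
    exact ⟨V, hVo.mem_nhds hxV, hVφ, hVψ, ε, hε, fun C hC g hg y hy => hV C hC hg y hy.1⟩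
  · refine ⟨Kᶜ ∩ ((chartAt (Euc m) x).source ∩ f ⁻¹' (chartAt (Euc n) (f x)).source),
      inter_mem (hK.isOpen_compl.mem_nhds hx) (inter_mem (chart_source_mem_nhds _ x)
        (f.contMDiff.continuous.continuousAt.preimage_mem_nhds (chart_source_mem_nhds _ (f x)))),
      fun y hy => hy.2.1, fun y hy => hy.2.2, 1, one_pos, fun C hC g _ y hy => ?_⟩
    exact absurd hy.2 (hC hy.1).1

theorem isOpen_weakTopology_transverseMaps [LocallyCompactSpace M] [T2Space M] (hS : IsClosed S)
    (h𝒮 : IsStratification n 𝒮 S) (hreg : IsARegular n 𝒮) {K : Set M} (hK : IsCompact K) :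
    IsOpen[weakTopology m n M N] (transverseMaps m n 𝒮 K) := by
  let _ := weakTopology m n M N
  refine isOpen_iff_forall_mem_open.2 fun f hf => ?_
  choose V hV hVφ hVψ ε hε hVT using
    exists_chartNhd_subset_transverseMaps_inter hS h𝒮 hreg hK.isClosed hf
  choose C hCx hCV hCc using fun x => local_compact_nhds (hV x)
  obtain ⟨t, -, hKt⟩ := hK.elim_nhds_subcover C fun x _ => hCx x
  refine ⟨⋂ x ∈ t, chartNhd 1 f (chartAt (Euc m) x) (chartAt (Euc n) (f x)) (C x) (ε x),
    fun g hg x hx => ?_, isOpen_biInter_finset fun x _ => ?_, ?_⟩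
  · obtain ⟨z, hz, hxz⟩ := mem_iUnion₂.1 (hKt hx)
    exact hVT z (C z) (hCV z) (mem_iInter₂.1 hg z hz) x ⟨hxz, hx⟩
  · exact isOpen_weakTopology_chartNhd (IsManifold.chart_mem_maximalAtlas x)
      (IsManifold.chart_mem_maximalAtlas (f x)) (hCc x) ((hCV x).trans (hVφ x))
      ((hVψ x).mono_left (hCV x)) (hε x)
  · exact mem_iInter₂.2 fun x _ => self_mem_chartNhd ((hVψ x).mono_left (hCV x)) (hε x)

theorem isOpen_strongTopology_transverseMaps [LocallyCompactSpace M] [T2Space M]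
    [SecondCountableTopology M] (hS : IsClosed S)
    (h𝒮 : IsStratification n 𝒮 S) (hreg : IsARegular n 𝒮) {K : Set M} (hK : IsClosed K) :
    IsOpen[strongTopology m n M N] (transverseMaps m n 𝒮 K) := by
  let _ := strongTopology m n M N
  rcases isEmpty_or_nonempty M with hM | hM
  · convert isOpen_univ
    exact eq_univ_of_forall fun f x => isEmptyElim x
  refine isOpen_iff_forall_mem_open.2 fun f hf => ?_
  choose V hV hVφ hVψ ε hε hVT using
    exists_chartNhd_subset_transverseMaps_inter hS h𝒮 hreg hK hf
  obtain ⟨c, U, C, hUo, hCc, hCU, hUV, hUf, hCcov⟩ := exists_locallyFinite_compact_cover V hV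
  -- The charts are restricted to U j to make their domains locally finite. Restriction leaves the
  -- underlying functions, and hence the derivative conditions, unchanged.
  refine ⟨⋂ j, chartNhd 1 f ((chartAt (Euc m) (c j)).restr (U j)) (chartAt (Euc n) (f (c j)))
    (C j) (ε (c j)), fun g hg x hx => ?_, ?_, ?_⟩
  · obtain ⟨j, hj⟩ := mem_iUnion.1 (hCcov ▸ mem_univ x)
    exact hVT (c j) (C j) ((hCU j).trans (hUV j)) (mem_iInter.1 hg j) x ⟨hj, hx⟩
  · refine TopologicalSpace.isOpen_generateFrom_of_mem ⟨1, f, ℕ, _, _, C, fun j => ε (c j), ?_,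
      fun j => ⟨restr_mem_maximalAtlas _ (IsManifold.chart_mem_maximalAtlas (c j)) (hUo j),
        IsManifold.chart_mem_maximalAtlas (f (c j)), hCc j, fun x hx => ?_,
        (hVψ (c j)).mono_left ((hCU j).trans (hUV j)), hε (c j)⟩, rfl⟩
    · refine hUf.subset fun j => ?_
      rw [OpenPartialHomeomorph.restr_source' _ _ (hUo j)]
      exact inter_subset_right
    · rw [OpenPartialHomeomorph.restr_source' _ _ (hUo j)]
      exact ⟨hVφ _ (hUV j (hCU j hx)), hCU j hx⟩
  · exact mem_iInter.2 fun j => self_mem_chartNhd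
      ((hVψ (c j)).mono_left ((hCU j).trans (hUV j))) (hε _)

end Open

/-! ### Compactly supported deformations are continuous for the strong topology -/

/-- Differentiation in the second variable keeps joint smoothness. In the inductive step the pair
(p, x) serves as parameter and the point of differentiation is a separate variable. -/
theorem contDiffAt_iteratedFDeriv_right {P E F : Type*} [NormedAddCommGroup P] [NormedSpace ℝ P]
    [NormedAddCommGroup E] [NormedSpace ℝ E] [NormedAddCommGroup F] [NormedSpace ℝ F]
    {H : P → E → F} {p₀ : P} {x₀ : E}
    (hH : ContDiffAt ℝ ∞ (fun z : P × E => H z.1 z.2) (p₀, x₀)) (k : ℕ) :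
    ContDiffAt ℝ ∞ (fun z : P × E => iteratedFDeriv ℝ k (H z.1) z.2) (p₀, x₀) := by
  induction k with
  | zero =>
    simp only [iteratedFDeriv_zero_eq_comp]
    exact (continuousMultilinearCurryFin0 ℝ E F).symm.contDiff.contDiffAt.comp (p₀, x₀) hH
  | succ k ih =>
    simp only [iteratedFDeriv_succ_eq_comp_left]
    refine (LinearIsometryEquiv.contDiff (𝕜 := ℝ) (E := E →L[ℝ] (E [×k]→L[ℝ] F))
      (F := E [×(k + 1)]→L[ℝ] F)
      (continuousMultilinearCurryLeftEquiv ℝ (fun _ : Fin (k + 1) => E) F).symm).contDiffAt.comp (p₀, x₀) ?_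
    refine ContDiffAt.fderiv (n := ∞) (f := fun z : P × E => iteratedFDeriv ℝ k (H z.1))
      (g := Prod.snd) ?_ contDiffAt_snd (by simp)
    exact ContDiffAt.comp (f := fun w : (P × E) × E => (w.1.1, w.2))
      (g := fun z : P × E => iteratedFDeriv ℝ k (H z.1) z.2) ((p₀, x₀), x₀) ih
      (by fun_prop)

section

variable {m n : ℕ} {M N : Type*}
  [TopologicalSpace M] [ChartedSpace (Euc m) M]
  [TopologicalSpace N] [ChartedSpace (Euc n) N]

theorem mem_chartNhd_of_eventuallyEq {r : ℕ} {f g h : C^∞⟮𝓡 m, M; 𝓡 n, N⟯}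
    {φ : OpenPartialHomeomorph M (Euc m)} {ψ : OpenPartialHomeomorph N (Euc n)} {K : Set M}
    {ε : ℝ} (hK : K ⊆ φ.source) (hg : g ∈ chartNhd r f φ ψ K ε)
    (hgh : ∀ x ∈ K, g =ᶠ[𝓝 x] h) : h ∈ chartNhd r f φ ψ K ε := by
  refine ⟨fun x hx => (hgh x hx).eq_of_nhds ▸ hg.1 hx, ?_⟩
  rintro _ ⟨x, hx, rfl⟩ k hk
  have hev : ψ ∘ g ∘ φ.symm =ᶠ[𝓝 (φ x)] ψ ∘ h ∘ φ.symm := by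
    have h1 := φ.continuousAt_symm (φ.map_source (hK hx))
    rw [ContinuousAt, φ.left_inv (hK hx)] at h1
    filter_upwards [h1.eventually (hgh x hx)] with z hz
    simp [hz]
  rw [← (hev.iteratedFDeriv ℝ k).eq_of_nhds]
  exact hg.2 _ (mem_image_of_mem _ hx) k hk

variable [IsManifold (𝓡 m) ∞ M] [IsManifold (𝓡 n) ∞ N]
  {P : Type*} [NormedAddCommGroup P] [NormedSpace ℝ P]

/-- Each condition is a strict inequality between jointly continuous functions at the points of a
compact set, so the tube lemma applies. -/
theorem eventually_mem_chartNhd {F : P → C^∞⟮𝓡 m, M; 𝓡 n, N⟯} {p₀ : P} {r : ℕ}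
    {f : C^∞⟮𝓡 m, M; 𝓡 n, N⟯}
    {φ : OpenPartialHomeomorph M (Euc m)} {ψ : OpenPartialHomeomorph N (Euc n)} {K : Set M}
    {ε : ℝ} (hφ : φ ∈ IsManifold.maximalAtlas (𝓡 m) ∞ M)
    (hψ : ψ ∈ IsManifold.maximalAtlas (𝓡 n) ∞ N) (hK : IsCompact K) (hKφ : K ⊆ φ.source)
    (hKψ : MapsTo f K ψ.source)
    (hF : ∀ x, ContMDiffAt (𝓘(ℝ, P).prod (𝓡 m)) (𝓡 n) ∞ (fun q : P × M => F q.1 q.2) (p₀, x))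
    (h₀ : F p₀ ∈ chartNhd r f φ ψ K ε) : ∀ᶠ p in 𝓝 p₀, F p ∈ chartNhd r f φ ψ K ε := by
  have h1 : ∀ᶠ p in 𝓝 p₀, ∀ x ∈ K, F p x ∈ ψ.source :=
    hK.eventually_forall_of_forall_eventually fun x hx =>
      (hF x).continuousAt.eventually_mem (ψ.open_source.mem_nhds (h₀.1 hx))
  have h2 : ∀ᶠ p in 𝓝 p₀, ∀ y ∈ φ '' K, ∀ k ∈ Iic r,
      ‖iteratedFDeriv ℝ k (ψ ∘ f ∘ φ.symm) y - iteratedFDeriv ℝ k (ψ ∘ F p ∘ φ.symm) y‖ < ε := by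
    refine (hK.image_of_continuousOn (φ.continuousOn.mono hKφ)).eventually_forall_of_forall_eventually
      fun y hy => ?_
    refine (finite_Iic r).eventually_all.2 fun k hk => ?_
    obtain ⟨x, hx, rfl⟩ := hy
    have hleft := φ.left_inv (hKφ hx)
    have hc1 : ContDiffAt ℝ ∞ (ψ ∘ f ∘ φ.symm) (φ x) :=
      contDiffAt_chart_comp hφ hψ f (φ.map_source (hKφ hx)) (by rw [hleft]; exact hKψ hx)
    have hc2 : ContDiffAt ℝ ∞ (fun z : P × Euc m => (ψ ∘ F z.1 ∘ φ.symm) z.2) (p₀, φ x) := by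
      have hs : ContMDiffAt (𝓘(ℝ, P).prod (𝓡 m)) (𝓘(ℝ, P).prod (𝓡 m)) ∞
          (fun z : P × Euc m => (z.1, φ.symm z.2)) (p₀, φ x) := by
        refine contMDiffAt_fst.prodMk ?_
        exact ContMDiffAt.comp (g := φ.symm) (f := Prod.snd) (p₀, φ x)
          ((contMDiffOn_symm_of_mem_maximalAtlas hφ).contMDiffAt
            (φ.open_target.mem_nhds (φ.map_source (hKφ hx)))) contMDiffAt_snd
      have h3 : ContMDiffAt (𝓘(ℝ, P).prod (𝓡 m)) (𝓡 n) ∞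
          (fun z : P × Euc m => F z.1 (φ.symm z.2)) (p₀, φ x) :=
        ContMDiffAt.comp (g := fun q : P × M => F q.1 q.2) (p₀, φ x)
          (by simpa only [hleft] using hF x) hs
      have h4 : ContMDiffAt (𝓘(ℝ, P).prod (𝓡 m)) (𝓡 n) ∞
          (fun z : P × Euc m => ψ (F z.1 (φ.symm z.2))) (p₀, φ x) :=
        ContMDiffAt.comp (g := ψ) (p₀, φ x)
          ((contMDiffOn_of_mem_maximalAtlas hψ).contMDiffAt (ψ.open_source.mem_nhds
            (by simpa only [hleft] using h₀.1 hx))) h3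
      rw [← modelWithCornersSelf_prod, chartedSpaceSelf_prod] at h4
      exact h4.contDiffAt
    have hcont : ContinuousAt (fun z : P × Euc m => ‖iteratedFDeriv ℝ k (ψ ∘ f ∘ φ.symm) z.2
        - iteratedFDeriv ℝ k (ψ ∘ F z.1 ∘ φ.symm) z.2‖) (p₀, φ x) := by
      refine (ContinuousAt.sub ?_ ?_).norm
      · exact ContinuousAt.comp (g := iteratedFDeriv ℝ k (ψ ∘ f ∘ φ.symm)) (f := Prod.snd)
          (hc1.continuousAt_iteratedFDeriv (by exact_mod_cast le_top)) continuousAt_snd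
      · exact (contDiffAt_iteratedFDeriv_right (H := fun p => ψ ∘ F p ∘ φ.symm) hc2 k).continuousAt
    exact hcont.eventually_lt continuousAt_const (h₀.2 _ (mem_image_of_mem _ hx) k hk)
  filter_upwards [h1, h2] with p hp1 hp2
  exact ⟨hp1, fun y hy k hk => hp2 y hy k hk⟩

/-- D meets only finitely many of the locally finite chart domains. The conditions on those persist
for p near `p₀`; on all others the map does not change at all. -/
theorem tendsto_strongTopology_of_eq_off_compact {F : P → C^∞⟮𝓡 m, M; 𝓡 n, N⟯} {p₀ : P}
    {D : Set M} (hD : IsCompact D) (hFD : ∀ p, ∀ x ∉ D, F p x = F p₀ x)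
    (hF : ∀ x, ContMDiffAt (𝓘(ℝ, P).prod (𝓡 m)) (𝓡 n) ∞ (fun q : P × M => F q.1 q.2) (p₀, x)) :
    Tendsto F (𝓝 p₀) (@nhds _ (strongTopology m n M N) (F p₀)) := by
  refine TopologicalSpace.tendsto_nhds_generateFrom_iff.2 ?_
  rintro W ⟨r, f, ι, φ, ψ, K, ε, hlf, h, rfl⟩ h₀
  have hfin := hlf.finite_nonempty_inter_compact hD
  have h1 := (hfin.eventually_all (l := 𝓝 p₀)
    (p := fun i p => F p ∈ chartNhd r f (φ i) (ψ i) (K i) (ε i))).2 fun i _ => by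
      obtain ⟨hφ, hψ, hK, hKφ, hKψ, -⟩ := h i
      exact eventually_mem_chartNhd hφ hψ hK hKφ hKψ hF (mem_iInter.1 h₀ i)
  filter_upwards [h1] with p hp
  refine mem_iInter.2 fun i => ?_
  by_cases hi : ((φ i).source ∩ D).Nonempty
  · exact hp i hi
  · refine mem_chartNhd_of_eventuallyEq (h i).2.2.2.1 (mem_iInter.1 h₀ i) fun x hx => ?_
    filter_upwards [(φ i).open_source.mem_nhds ((h i).2.2.2.1 hx)] with z hz
    exact (hFD p z fun hzD => hi ⟨z, hz, hzD⟩).symm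

end

/-! ### Affine perturbations that are not transverse form a null set -/

/-- The parameters `(t, L)` of the affine maps `x ↦ t + L x` from `ℝᵐ` to `ℝⁿ`. -/
abbrev AffineParam (m n : ℕ) : Type := Euc n × (Euc m →L[ℝ] Euc n)

section

variable {m n : ℕ}

/-- The projection of `ℝⁿ` onto its first `k` coordinates. -/
def truncate (n k : ℕ) : Euc n →L[ℝ] Euc n :=
  ∑ j : Fin n, if (j : ℕ) < k then
    (EuclideanSpace.proj (𝕜 := ℝ) j).smulRight (EuclideanSpace.single j (1 : ℝ)) else 0

theorem truncate_apply (k : ℕ) (v : Euc n) (j : Fin n) :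
    truncate n k v j = if (j : ℕ) < k then v j else 0 := by
  have h : ∀ l : Fin n, ((if (l : ℕ) < k then (EuclideanSpace.proj (𝕜 := ℝ) l).smulRight
      (EuclideanSpace.single l (1 : ℝ)) else 0 : Euc n →L[ℝ] Euc n) v) j
      = if l = j then (if (j : ℕ) < k then v j else 0) else 0 := by
    intro l
    by_cases hl : l = j
    · subst hl
      by_cases hk : (l : ℕ) < k <;> simp [hk]
    · split_ifs <;> simp [Ne.symm hl]
  simp [truncate, h]

/-- The linear map `R` with its `i`-th row replaced by `b`. -/
def replaceRow (i : Fin n) (R : Euc m →L[ℝ] Euc n) (b : Euc m →L[ℝ] ℝ) : Euc m →L[ℝ] Euc n :=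
  R + (b - (EuclideanSpace.proj i).comp R).smulRight (EuclideanSpace.single i (1 : ℝ))

theorem replaceRow_apply (i : Fin n) (R : Euc m →L[ℝ] Euc n) (b : Euc m →L[ℝ] ℝ) (v : Euc m)
    (j : Fin n) : replaceRow i R b v j = if j = i then b v else R v j := by
  by_cases hj : j = i
  · subst hj
    simp [replaceRow]
  · simp [replaceRow, hj]

/-- The linear combination of the rows of `R` of index at least `k` with coefficients `z`. -/
def rowCombination (k : ℕ) (z : Euc n) (R : Euc m →L[ℝ] Euc n) : Euc m →L[ℝ] ℝ :=
  ∑ j ∈ Finset.univ.filter (fun j : Fin n => k ≤ (j : ℕ)), z j • (EuclideanSpace.proj j).comp R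

theorem rowCombination_apply (k : ℕ) (z : Euc n) (R : Euc m →L[ℝ] Euc n) (v : Euc m) :
    rowCombination k z R v = ∑ j ∈ Finset.univ.filter (fun j : Fin n => k ≤ (j : ℕ)), z j * R v j := by
  simp [rowCombination]

/-- The parameters `(t, L)` for which the `1`-jet of `h + t + L` at a point of `X` lies over a point
`q s` with `s ∈ Y` having vanishing coordinates from the `k`-th on, and whose derivative, pulled
back by that of `q`, has its `i`-th row dependent on the other rows of index at least `k`. -/
def degenerateParams (h : Euc m → Euc n) (X : Set (Euc m)) (q : Euc n → Euc n) (Y : Set (Euc n))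
    (k : ℕ) (i : Fin n) : Set (AffineParam m n) :=
  {p | ∃ x ∈ X, ∃ s ∈ Y, s ∈ lastZero n k ∧ q s = h x + (p.1 + p.2 x) ∧
    ∃ R : Euc m →L[ℝ] Euc n, (fderiv ℝ q s).comp R = fderiv ℝ h x + p.2 ∧
      ∃ a : Euc n, a i = 0 ∧ (EuclideanSpace.proj i).comp R = rowCombination k a R}

-- A degenerate parameter is recovered from (x, s, R, a), and these data fit in a hyperplane of the
-- parameter space itself. The vector slot holds s in its first k coordinates and a in the others,
-- with `a i = 0`. The matrix slot holds R with row i, which the other rows determine, replaced by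
-- x. The map `Φ` solves the two defining equations for t and L; being differentiable, it preserves
-- null sets.
open MeasureTheory in
theorem measure_degenerateParams {h : Euc m → Euc n} {X : Set (Euc m)} (hX : IsOpen X)
    (hh : ContDiffOn ℝ ∞ h X) {q : Euc n → Euc n} {Y : Set (Euc n)} (hY : IsOpen Y)
    (hq : ContDiffOn ℝ ∞ q Y) {k : ℕ} {i : Fin n} (hi : k ≤ (i : ℕ))
    [MeasurableSpace (AffineParam m n)] [BorelSpace (AffineParam m n)]
    (μ : Measure (AffineParam m n)) [μ.IsAddHaarMeasure] :
    μ (degenerateParams h X q Y k i) = 0 := by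
  set pt : AffineParam m n → Euc m := fun w =>
    (InnerProductSpace.toDual ℝ (Euc m)).symm ((EuclideanSpace.proj i).comp w.2) with hpt
  set rw' : AffineParam m n → (Euc m →L[ℝ] Euc n) := fun w =>
    replaceRow i w.2 (rowCombination k w.1 w.2) with hrw
  set L : AffineParam m n → (Euc m →L[ℝ] Euc n) := fun w =>
    (fderiv ℝ q (truncate n k w.1)).comp (rw' w) - fderiv ℝ h (pt w) with hL
  set Φ : AffineParam m n → AffineParam m n := fun w =>
    (q (truncate n k w.1) - h (pt w) - L w (pt w), L w) with hΦ
  set Z : Submodule ℝ (AffineParam m n) :=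
    LinearMap.ker ((EuclideanSpace.proj (𝕜 := ℝ) i).comp
      (ContinuousLinearMap.fst ℝ (Euc n) (Euc m →L[ℝ] Euc n))).toLinearMap with hZ
  set D : Set (AffineParam m n) :=
    {w | w ∈ Z ∧ truncate n k w.1 ∈ Y ∧ pt w ∈ X} with hD
  have hZtop : Z ≠ ⊤ := by
    intro h
    have : ((EuclideanSpace.single i (1 : ℝ), 0) : AffineParam m n) ∈ Z := h ▸ Submodule.mem_top
    simp [hZ] at this
  have hnull : μ D = 0 :=
    measure_mono_null (fun w hw => hw.1) (Measure.addHaar_submodule μ Z hZtop)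
  have hsub : degenerateParams h X q Y k i ⊆ Φ '' D := by
    rintro ⟨t, l⟩ ⟨x, hx, s, hs, hsk, hqs, R, hR, a, hai, haR⟩
    set b : Euc m →L[ℝ] ℝ := InnerProductSpace.toDual ℝ (Euc m) x with hb
    -- The first k coordinates come from s, the remaining ones from a.
    set z : Euc n := s + a - truncate n k a with hz
    set w : AffineParam m n := (z, replaceRow i R b) with hw
    have hzk : ∀ j : Fin n, k ≤ (j : ℕ) → z j = a j := fun j hj => by
      simp [hz, truncate_apply, hsk j hj, not_lt.2 hj]
    have htr : truncate n k z = s := by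
      ext j
      rw [truncate_apply]
      split_ifs with hj
      · simp [hz, truncate_apply, hj]
      · exact (hsk j (not_lt.1 hj)).symm
    have hptw : pt w = x := by
      have : (EuclideanSpace.proj i).comp (replaceRow i R b) = b := by
        ext v
        simp [replaceRow_apply]
      change (InnerProductSpace.toDual ℝ (Euc m)).symm
        ((EuclideanSpace.proj i).comp (replaceRow i R b)) = x
      rw [this, hb, LinearIsometryEquiv.symm_apply_apply]
    -- Overwriting row i with x does no harm: its coefficient in the combination is zero.
    have hrc : rowCombination k z (replaceRow i R b) = rowCombination k a R := by
      ext1 v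
      rw [rowCombination_apply, rowCombination_apply]
      refine Finset.sum_congr rfl fun j hj => ?_
      rw [hzk j (Finset.mem_filter.1 hj).2, replaceRow_apply]
      split_ifs with hji
      · rw [hji, hai, zero_mul, zero_mul]
      · rfl
    have hrww : rw' w = R := by
      ext v j
      change replaceRow i (replaceRow i R b)
        (rowCombination k z (replaceRow i R b)) v j = R v j
      rw [hrc, ← haR, replaceRow_apply, replaceRow_apply]
      split_ifs with hji
      · rw [hji]
        rfl
      · rfl
    have hLw : L w = l := by
      simp only [hL, hrww, hptw]
      rw [show truncate n k w.1 = s from htr, hR]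
      abel
    refine ⟨w, ⟨?_, ?_, ?_⟩, ?_⟩
    · simp [hZ, hw, hzk i hi, hai]
    · rwa [show truncate n k w.1 = s from htr]
    · rwa [hptw]
    · simp only [hΦ, hLw, hptw]
      rw [show truncate n k w.1 = s from htr, hqs]
      ext1
      · simp
      · rfl
  have hdiff : DifferentiableOn ℝ Φ D := by
    intro w hw
    have hq1 : ContDiffAt ℝ ∞ q (truncate n k w.1) := hq.contDiffAt (hY.mem_nhds hw.2.1)
    have hh1 : ContDiffAt ℝ ∞ h (pt w) := hh.contDiffAt (hX.mem_nhds hw.2.2)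
    have dT : DifferentiableAt ℝ (fun w : AffineParam m n => truncate n k w.1) w := by fun_prop
    have dpt : DifferentiableAt ℝ pt w := by
      have h1 : DifferentiableAt ℝ (fun w : AffineParam m n =>
          (EuclideanSpace.proj (𝕜 := ℝ) i).comp w.2) w := by fun_prop
      exact ((InnerProductSpace.toDual ℝ (Euc m)).symm.differentiable _).comp w h1
    have dq : DifferentiableAt ℝ (fun w : AffineParam m n => q (truncate n k w.1)) w :=
      DifferentiableAt.comp w (hq1.differentiableAt (by simp)) dT
    have dh : DifferentiableAt ℝ (fun w => h (pt w)) w :=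
      DifferentiableAt.comp w (hh1.differentiableAt (by simp)) dpt
    have dq' : DifferentiableAt ℝ (fun w : AffineParam m n => fderiv ℝ q (truncate n k w.1)) w :=
      DifferentiableAt.comp (g := fderiv ℝ q) w
        ((hq1.fderiv_right (m := 1) (by norm_cast)).differentiableAt (by simp)) dT
    have dh' : DifferentiableAt ℝ (fun w => fderiv ℝ h (pt w)) w :=
      DifferentiableAt.comp (g := fderiv ℝ h) w
        ((hh1.fderiv_right (m := 1) (by norm_cast)).differentiableAt (by simp)) dpt
    have drc : DifferentiableAt ℝ (fun w : AffineParam m n => rowCombination k w.1 w.2) w := by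
      unfold rowCombination
      fun_prop
    have drw : DifferentiableAt ℝ rw' w := by
      have h1 : DifferentiableAt ℝ (fun w : AffineParam m n => rowCombination k w.1 w.2
          - (EuclideanSpace.proj (𝕜 := ℝ) i).comp w.2) w := by fun_prop
      have h2 := ((ContinuousLinearMap.smulRightL ℝ (Euc m) (Euc n)).flip
        (EuclideanSpace.single i (1 : ℝ))).differentiableAt.comp w h1
      exact differentiableAt_snd.add h2
    have dL : DifferentiableAt ℝ L w := (dq'.clm_comp drw).sub dh'
    exact (((dq.sub dh).sub (dL.clm_apply dpt)).prodMk dL).differentiableWithinAt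
  exact measure_mono_null hsub
    (addHaar_image_eq_zero_of_differentiableOn_of_addHaar_eq_zero μ hdiff hnull)

/-- If a linear map fails to be transverse to the vanishing of the coordinates from the `k`-th on,
then one of its rows of index at least `k` is a linear combination of the others. -/
theorem exists_row_dependent {k : ℕ} {R : Euc m →L[ℝ] Euc n}
    (hR : lastZero n k ⊔ R.toLinearMap.range ≠ ⊤) :
    ∃ i : Fin n, k ≤ (i : ℕ) ∧ ∃ a : Euc n, a i = 0 ∧
      (EuclideanSpace.proj i).comp R = rowCombination k a R := by
  classical
  -- A nonzero u orthogonal to the sum is supported on the indices at least k and annihilates the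
  -- range of R. This is a linear relation among those rows, solved for a row i with `u i ≠ 0`.
  have h1 : (lastZero n k ⊔ R.toLinearMap.range)ᗮ ≠ ⊥ := by
    rwa [Ne, Submodule.orthogonal_eq_bot_iff]
  obtain ⟨u, hu, hu0⟩ := Submodule.exists_mem_ne_zero_of_ne_bot h1
  have huk : ∀ j : Fin n, (j : ℕ) < k → u j = 0 := fun j hj => by
    have h2 : EuclideanSpace.single j (1 : ℝ) ∈ lastZero n k := fun l hl => by
      have : l ≠ j := fun h => by subst h; omega
      simp [this]
    simpa [EuclideanSpace.inner_single_left] using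
      (Submodule.mem_orthogonal _ u).1 hu _ (Submodule.mem_sup_left h2)
  have huR : ∀ v, ∑ j, u j * R v j = 0 := fun v => by
    have := (Submodule.mem_orthogonal _ u).1 hu (R v) (Submodule.mem_sup_right ⟨v, rfl⟩)
    simpa [PiLp.inner_apply] using this
  obtain ⟨i, hi⟩ : ∃ i, u i ≠ 0 := by
    by_contra hcon
    push Not at hcon
    exact hu0 (by ext j; simp [hcon j])
  have hik : k ≤ (i : ℕ) := not_lt.1 fun h => hi (huk i h)
  refine ⟨i, hik, WithLp.toLp 2 fun j => if j = i then 0 else -(u j / u i), by simp, ?_⟩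
  ext1 v
  rw [rowCombination_apply]
  have h3 := huR v
  rw [← Finset.sum_filter_add_sum_filter_not Finset.univ (fun j : Fin n => k ≤ (j : ℕ)),
    Finset.sum_eq_zero (s := Finset.univ.filter fun j : Fin n => ¬ k ≤ (j : ℕ))
      (fun j hj => by rw [huk j (not_le.1 (Finset.mem_filter.1 hj).2), zero_mul]), add_zero,
    ← Finset.add_sum_erase _ _ (Finset.mem_filter.2 ⟨Finset.mem_univ i, hik⟩)] at h3
  rw [← Finset.add_sum_erase _ _ (Finset.mem_filter.2 ⟨Finset.mem_univ i, hik⟩)]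
  have h4 : ∀ s : Finset (Fin n), i ∉ s →
      ∑ j ∈ s, (WithLp.toLp 2 fun j => if j = i then 0 else -(u j / u i) : Euc n) j * R v j
      = -(∑ j ∈ s, u j * R v j) / u i := fun s hs => by
    rw [← Finset.sum_neg_distrib, Finset.sum_div]
    refine Finset.sum_congr rfl fun j hj => ?_
    have : j ≠ i := fun h => hs (h ▸ hj)
    simp only [this, if_false]
    ring
  rw [h4 _ (Finset.notMem_erase _ _)]
  have h5 : (EuclideanSpace.proj i).comp R v = R v i := rfl
  rw [h5]
  simp only [if_true, zero_mul, zero_add]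
  field_simp
  linarith

end

/-! ### Making a map transverse over a compact set by a small compactly supported perturbation -/

section

variable {m n : ℕ} {M N : Type*}
  [TopologicalSpace M] [ChartedSpace (Euc m) M]
  [TopologicalSpace N] [ChartedSpace (Euc n) N]

/-- By second countability, countably many of the neighbourhoods given by local finiteness cover S,
and each meets finitely many strata. -/
theorem IsStratification.countable [SecondCountableTopology N] {𝒮 : Set (Set N)} {S : Set N}
    (h𝒮 : IsStratification n 𝒮 S) : 𝒮.Countable := by
  choose! U hU hfin using h𝒮.locallyFinite
  obtain ⟨t, htS, htc, hcov⟩ := TopologicalSpace.countable_cover_nhdsWithin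
    (f := U) (s := S) fun x hx => mem_nhdsWithin_of_mem_nhds (hU x hx)
  refine (htc.biUnion fun x hx => (hfin x (htS hx)).countable).mono fun A hA => ?_
  obtain ⟨y, hy⟩ := h𝒮.nonempty A hA
  have hyS : y ∈ S := h𝒮.sUnion_eq ▸ mem_sUnion_of_mem hy hA
  obtain ⟨x, hx, hyx⟩ := mem_iUnion₂.1 (hcov hyS)
  exact mem_iUnion₂.2 ⟨x, hx, hA, y, hy, hyx⟩

theorem IsSubmanifold.exists_countable_charts [SecondCountableTopology N] {A : Set N}
    (hA : IsSubmanifold n A) :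
    ∃ (k : ℕ) (χ : N → OpenPartialHomeomorph N (Euc n)) (t : Set N), t.Countable ∧
      (∀ y ∈ t, χ y ∈ IsManifold.maximalAtlas (𝓡 n) ∞ N ∧
        ∀ z ∈ (χ y).source, z ∈ A ↔ ∀ i : Fin n, k ≤ (i : ℕ) → χ y z i = 0) ∧
      A ⊆ ⋃ y ∈ t, (χ y).source := by
  obtain ⟨k, -, hk⟩ := hA
  classical
  have hk' : ∀ x, ∃ ψ : OpenPartialHomeomorph N (Euc n), x ∈ A →
      ψ ∈ IsManifold.maximalAtlas (𝓡 n) ∞ N ∧ x ∈ ψ.source ∧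
        ∀ y ∈ ψ.source, y ∈ A ↔ ∀ i : Fin n, k ≤ (i : ℕ) → ψ y i = 0 := fun x => by
    by_cases hx : x ∈ A
    · obtain ⟨ψ, hψ⟩ := hk x hx
      exact ⟨ψ, fun _ => hψ⟩
    · exact ⟨chartAt (Euc n) x, fun h => absurd h hx⟩
  choose χ hχ using hk'
  obtain ⟨t, htA, htc, hcov⟩ := TopologicalSpace.countable_cover_nhdsWithin
    (f := fun x => (χ x).source) (s := A) fun x hx => mem_nhdsWithin_of_mem_nhds (
      (χ x).open_source.mem_nhds (hχ x hx).2.1)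
  exact ⟨k, χ, t, htc, fun y hy => ⟨(hχ y (htA hy)).1, (hχ y (htA hy)).2.2⟩, hcov⟩

variable [IsManifold (𝓡 m) ∞ M]

/-- In the chart ψ, the affine map times a bump function is added to f. The bump is 1 near C, so
there the 1-jet is shifted by the full affine map, and 0 off D, so the result glues with f. -/
theorem exists_affine_deformation [T2Space M] [SecondCountableTopology M] [LocallyCompactSpace M]
    (f : C^∞⟮𝓡 m, M; 𝓡 n, N⟯)
    {φ : OpenPartialHomeomorph M (Euc m)} {ψ : OpenPartialHomeomorph N (Euc n)}
    (hφ : φ ∈ IsManifold.maximalAtlas (𝓡 m) ∞ M) (hψ : ψ ∈ IsManifold.maximalAtlas (𝓡 n) ∞ N)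
    {C D : Set M} (hC : IsClosed C) (hD : IsCompact D) (hCD : C ⊆ interior D)
    (hDφ : D ⊆ φ.source) (hDψ : MapsTo f D ψ.source) :
    ∃ F : AffineParam m n → C^∞⟮𝓡 m, M; 𝓡 n, N⟯, F 0 = f ∧ (∀ p, ∀ x ∉ D, F p x = f x) ∧
      (∀ x, ContMDiffAt (𝓘(ℝ, AffineParam m n).prod (𝓡 m)) (𝓡 n) ∞
        (fun q : AffineParam m n × M => F q.1 q.2) (0, x)) ∧
      ∀ᶠ p in 𝓝 (0 : AffineParam m n), ∀ x ∈ C, F p x ∈ ψ.source ∧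
        ∀ᶠ z in 𝓝 x, ψ (F p z) = ψ (f z) + (p.1 + p.2 (φ z)) := by
  classical
  obtain ⟨ρ, hρ1, hρ0, -⟩ := exists_contMDiffMap_one_nhds_of_subset_interior (n := (⊤ : ℕ∞)) (𝓡 m)
    hC hCD
  set G : AffineParam m n × M → Euc n :=
    fun q => ψ (f q.2) + ρ q.2 • (q.1.1 + q.1.2 (φ q.2)) with hG
  set V : Set M := φ.source ∩ f ⁻¹' ψ.source with hV
  have hVo : IsOpen V := φ.open_source.inter (ψ.open_source.preimage f.contMDiff.continuous)
  have hDV : D ⊆ V := fun x hx => ⟨hDφ hx, hDψ hx⟩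
  have hGs : ∀ (p : AffineParam m n) (x : M), x ∈ V →
      ContMDiffAt (𝓘(ℝ, AffineParam m n).prod (𝓡 m)) (𝓡 n) ∞ G (p, x) := by
    intro p x hx
    have h1 : ContMDiffAt (𝓘(ℝ, AffineParam m n).prod (𝓡 m)) (𝓡 n) ∞
        (fun q : AffineParam m n × M => ψ (f q.2)) (p, x) :=
      ContMDiffAt.comp (g := fun z => ψ (f z)) (p, x)
        (ContMDiffAt.comp (g := ψ) x ((contMDiffOn_of_mem_maximalAtlas hψ).contMDiffAt
          (ψ.open_source.mem_nhds hx.2)) (f.contMDiff x)) contMDiffAt_snd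
    have h2 : ContMDiffAt (𝓘(ℝ, AffineParam m n).prod (𝓡 m)) 𝓘(ℝ, ℝ) ∞
        (fun q : AffineParam m n × M => ρ q.2) (p, x) :=
      ContMDiffAt.comp (g := ρ) (p, x) (ρ.contMDiff x) contMDiffAt_snd
    have h3 : ContMDiffAt (𝓘(ℝ, AffineParam m n).prod (𝓡 m)) (𝓡 m) ∞
        (fun q : AffineParam m n × M => φ q.2) (p, x) :=
      ContMDiffAt.comp (g := φ) (p, x) ((contMDiffOn_of_mem_maximalAtlas hφ).contMDiffAt
        (φ.open_source.mem_nhds hx.1)) contMDiffAt_snd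
    have h4 : ContMDiffAt (𝓘(ℝ, AffineParam m n).prod (𝓡 m)) (𝓡 n) ∞
        (fun q : AffineParam m n × M => q.1.1) (p, x) :=
      ContMDiffAt.comp (I' := 𝓘(ℝ, AffineParam m n)) (g := Prod.fst) (p, x)
        contDiff_fst.contMDiff.contMDiffAt contMDiffAt_fst
    have h5 : ContMDiffAt (𝓘(ℝ, AffineParam m n).prod (𝓡 m)) 𝓘(ℝ, Euc m →L[ℝ] Euc n) ∞
        (fun q : AffineParam m n × M => q.1.2) (p, x) :=
      ContMDiffAt.comp (I' := 𝓘(ℝ, AffineParam m n)) (g := Prod.snd) (p, x)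
        contDiff_snd.contMDiff.contMDiffAt contMDiffAt_fst
    exact h1.add (h2.smul (h4.add (h5.clm_apply h3)))
  -- For these parameters the perturbed values stay in the target of ψ, so they can be carried back
  -- to N.
  set Ω : Set (AffineParam m n) := {p | ∀ x ∈ D, G (p, x) ∈ ψ.target} with hΩ
  have hG0 : ∀ x, G (0, x) = ψ (f x) := fun x => by simp [hG]
  have hΩ0 : Ω ∈ 𝓝 (0 : AffineParam m n) :=
    hD.eventually_forall_of_forall_eventually (P := fun p x => G (p, x) ∈ ψ.target) fun x hx =>
      (hGs 0 x (hDV hx)).continuousAt.eventually_mem (ψ.open_target.mem_nhds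
        (by rw [hG0]; exact ψ.map_source (hDψ hx)))
  have hGt : ∀ p ∈ Ω, ∀ x ∈ V, G (p, x) ∈ ψ.target := by
    intro p hp x hx
    by_cases hxD : x ∈ D
    · exact hp x hxD
    · simpa [hG, hρ0 x hxD] using ψ.map_source hx.2
  set F₀ : AffineParam m n × M → N :=
    fun q => if q.2 ∈ D then ψ.symm (G q) else f q.2 with hF₀
  have hF₀V : ∀ p, ∀ x ∈ V, F₀ (p, x) = ψ.symm (G (p, x)) := by
    intro p x hx
    by_cases hxD : x ∈ D
    · simp [hF₀, hxD]
    · simp [hF₀, hxD, hG, hρ0 x hxD, ψ.left_inv hx.2]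
  have hF₀s : ∀ p ∈ Ω, ∀ x, ContMDiffAt (𝓘(ℝ, AffineParam m n).prod (𝓡 m)) (𝓡 n) ∞ F₀ (p, x) := by
    intro p hp x
    by_cases hx : x ∈ V
    · have h1 : ContMDiffAt (𝓘(ℝ, AffineParam m n).prod (𝓡 m)) (𝓡 n) ∞
          (fun q => ψ.symm (G q)) (p, x) :=
        ContMDiffAt.comp (g := ψ.symm) (p, x)
          ((contMDiffOn_symm_of_mem_maximalAtlas hψ).contMDiffAt
            (ψ.open_target.mem_nhds (hGt p hp x hx))) (hGs p x hx)
      refine h1.congr_of_eventuallyEq ?_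
      filter_upwards [continuousAt_snd.eventually_mem (hVo.mem_nhds hx)] with q hq
      exact hF₀V q.1 q.2 hq
    · have h1 : ContMDiffAt (𝓘(ℝ, AffineParam m n).prod (𝓡 m)) (𝓡 n) ∞
          (fun q : AffineParam m n × M => f q.2) (p, x) :=
        ContMDiffAt.comp (g := f) (p, x) (f.contMDiff x) contMDiffAt_snd
      refine h1.congr_of_eventuallyEq ?_
      filter_upwards [continuousAt_snd.eventually_mem
        (hD.isClosed.isOpen_compl.mem_nhds fun h => hx (hDV h))] with q hq
      exact if_neg hq
  -- Outside `Ω` the value f is a filler; only parameters near 0 matter.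
  set F : AffineParam m n → C^∞⟮𝓡 m, M; 𝓡 n, N⟯ := fun p =>
    if hp : p ∈ Ω then ⟨fun x => F₀ (p, x), fun x =>
      ContMDiffAt.comp (g := F₀) (I' := 𝓘(ℝ, AffineParam m n).prod (𝓡 m)) x (hF₀s p hp x)
        (contMDiffAt_const.prodMk contMDiffAt_id)⟩
    else f with hF
  have hFΩ : ∀ p ∈ Ω, ∀ x, F p x = F₀ (p, x) := fun p hp x => by
    have h1 : F p = _ := dif_pos hp
    rw [h1]
    rfl
  refine ⟨F, ?_, ?_, ?_, ?_⟩
  · ext x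
    rw [hFΩ 0 (mem_of_mem_nhds hΩ0)]
    by_cases hxD : x ∈ D
    · rw [hF₀V _ _ (hDV hxD), hG0, ψ.left_inv (hDψ hxD)]
    · exact if_neg hxD
  · intro p x hx
    by_cases hp : p ∈ Ω
    · rw [hFΩ p hp]
      exact if_neg hx
    · have h1 : F p = f := dif_neg hp
      rw [h1]
  · intro x
    refine (hF₀s 0 (mem_of_mem_nhds hΩ0) x).congr_of_eventuallyEq ?_
    filter_upwards [continuousAt_fst.eventually_mem (x := ((0 : AffineParam m n), x)) hΩ0] with q hq
    exact hFΩ q.1 hq q.2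
  · filter_upwards [hΩ0] with p hp x hx
    have hxD : x ∈ interior D := hCD hx
    have hFV : ∀ z ∈ V, F p z = ψ.symm (G (p, z)) := fun z hz => by
      rw [hFΩ p hp, hF₀V p z hz]
    refine ⟨?_, ?_⟩
    · rw [hFV x (hDV (interior_subset hxD))]
      exact ψ.map_target (hGt p hp x (hDV (interior_subset hxD)))
    · filter_upwards [isOpen_interior.mem_nhds hxD, (eventually_nhdsSet_iff_forall.1 hρ1) x hx]
        with z hz hz1
      have hzV := hDV (interior_subset hz)
      rw [hFV z hzV, ψ.right_inv (hGt p hp z hzV)]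
      simp [hG, hz1]

variable [IsManifold (𝓡 n) ∞ N]

/-- The perturbation is affine in ψ while A is flat in χ. Near x the transition map composed with g
read in χ equals h + t + L; its value and derivative at x are the two equations, with R the
derivative of g read in χ. -/
theorem exists_mem_degenerateParams {f g : C^∞⟮𝓡 m, M; 𝓡 n, N⟯}
    {φ : OpenPartialHomeomorph M (Euc m)} {ψ χ : OpenPartialHomeomorph N (Euc n)}
    (hφ : φ ∈ IsManifold.maximalAtlas (𝓡 m) ∞ M) (hψ : ψ ∈ IsManifold.maximalAtlas (𝓡 n) ∞ N)
    (hχ : χ ∈ IsManifold.maximalAtlas (𝓡 n) ∞ N) {A : Set N} {k : ℕ}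
    (hA : ∀ z ∈ χ.source, z ∈ A ↔ ∀ i : Fin n, k ≤ (i : ℕ) → χ z i = 0) {x : M}
    (hx : x ∈ φ.source) (hfx : f x ∈ ψ.source) (hgx : g x ∈ ψ.source) (hgxχ : g x ∈ χ.source)
    {p : AffineParam m n} (hp : ∀ᶠ z in 𝓝 x, ψ (g z) = ψ (f z) + (p.1 + p.2 (φ z)))
    (hg : ¬ TransverseAt g A x) :
    ∃ i : Fin n, k ≤ (i : ℕ) ∧ p ∈ degenerateParams (ψ ∘ f ∘ φ.symm)
      (φ.target ∩ φ.symm ⁻¹' (f ⁻¹' ψ.source)) (ψ ∘ χ.symm) (χ.target ∩ χ.symm ⁻¹' ψ.source)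
      k i := by
  obtain ⟨hgA, hsup⟩ := Classical.not_imp.1 hg
  rw [sup_range_eq_top_iff hφ hχ g A hx hgxχ, chartTangent_eq_lastZero hχ hA hgxχ hgA] at hsup
  obtain ⟨i, hi, a, hai, ha⟩ := exists_row_dependent hsup
  have hxs := φ.left_inv hx
  have hgs := χ.left_inv hgxχ
  refine ⟨i, hi, φ x, ⟨φ.map_source hx, by simpa [hxs] using hfx⟩, χ (g x),
    ⟨χ.map_source hgxχ, by simpa [hgs] using hgx⟩, (hA _ hgxχ).1 hgA, ?_,
    fderiv ℝ (χ ∘ g ∘ φ.symm) (φ x), ?_, a, hai, ha⟩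
  · simpa [hgs, hxs] using hp.self_of_nhds
  · have hφt : Tendsto φ.symm (𝓝 (φ x)) (𝓝 x) := by
      simpa [ContinuousAt, hxs] using φ.continuousAt_symm (φ.map_source hx)
    have hq : DifferentiableAt ℝ (ψ ∘ χ.symm) (χ (g x)) :=
      (contDiffAt_chart_comp_symm hψ hχ (χ.map_source hgxχ)
        (by rwa [hgs])).differentiableAt (by simp)
    have hR : DifferentiableAt ℝ (χ ∘ g ∘ φ.symm) (φ x) :=
      (contDiffAt_chart_comp hφ hχ g (φ.map_source hx) (by rwa [hxs])).differentiableAt (by simp)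
    have hh : DifferentiableAt ℝ (ψ ∘ f ∘ φ.symm) (φ x) :=
      (contDiffAt_chart_comp hφ hψ f (φ.map_source hx) (by rwa [hxs])).differentiableAt (by simp)
    have hval : (χ ∘ g ∘ φ.symm) (φ x) = χ (g x) := by simp [hxs]
    rw [← hval] at hq
    have h1 := fderiv_comp (φ x) hq hR
    rw [hval] at h1
    have hev1 : (ψ ∘ χ.symm) ∘ (χ ∘ g ∘ φ.symm) =ᶠ[𝓝 (φ x)]
        fun z => (ψ ∘ f ∘ φ.symm) z + (p.1 + p.2 z) := by
      filter_upwards [hφt.eventually hp, hφt.eventually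
        (g.contMDiff.continuous.continuousAt.eventually_mem (χ.open_source.mem_nhds hgxχ)),
        φ.open_target.mem_nhds (φ.map_source hx)] with z hz1 hz2 hz3
      simp only [Function.comp_apply, χ.left_inv hz2, hz1, φ.right_inv hz3]
    rw [← h1, hev1.fderiv_eq]
    exact (hh.hasFDerivAt.add ((p.2.hasFDerivAt).const_add p.1)).fderiv

open MeasureTheory in
theorem exists_transverse_perturbation [T2Space M] [SecondCountableTopology M]
    [LocallyCompactSpace M] [SecondCountableTopology N]
    {𝒮 : Set (Set N)} {S : Set N} (h𝒮 : IsStratification n 𝒮 S) (f : C^∞⟮𝓡 m, M; 𝓡 n, N⟯)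
    {φ : OpenPartialHomeomorph M (Euc m)} {ψ : OpenPartialHomeomorph N (Euc n)}
    (hφ : φ ∈ IsManifold.maximalAtlas (𝓡 m) ∞ M) (hψ : ψ ∈ IsManifold.maximalAtlas (𝓡 n) ∞ N)
    {C D : Set M} (hC : IsClosed C) (hD : IsCompact D) (hCD : C ⊆ interior D)
    (hDφ : D ⊆ φ.source) (hDψ : MapsTo f D ψ.source) {O : Set C^∞⟮𝓡 m, M; 𝓡 n, N⟯}
    (hO : O ∈ @nhds _ (strongTopology m n M N) f) :
    ∃ g ∈ O, (∀ x ∉ D, g x = f x) ∧ g ∈ transverseMaps m n 𝒮 C := by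
  obtain ⟨F, hF0, hFD, hFs, hFC⟩ := exists_affine_deformation f hφ hψ hC hD hCD hDφ hDψ
  have hlim : Tendsto F (𝓝 0) (@nhds _ (strongTopology m n M N) (F 0)) :=
    tendsto_strongTopology_of_eq_off_compact hD
      (fun p x hx => by rw [hFD p x hx, hFD 0 x hx]) hFs
  rw [hF0] at hlim
  have hgood := (hlim hO : F ⁻¹' O ∈ 𝓝 0)
  let _ : MeasurableSpace (AffineParam m n) := borel _
  have _ : BorelSpace (AffineParam m n) := ⟨rfl⟩
  set μ : Measure (AffineParam m n) := Measure.addHaar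
  have h𝒮A : ∀ A : Set N, ∃ (k : ℕ) (χ : N → OpenPartialHomeomorph N (Euc n)) (t : Set N),
      A ∈ 𝒮 → t.Countable ∧
      (∀ y ∈ t, χ y ∈ IsManifold.maximalAtlas (𝓡 n) ∞ N ∧
        ∀ z ∈ (χ y).source, z ∈ A ↔ ∀ i : Fin n, k ≤ (i : ℕ) → χ y z i = 0) ∧
      A ⊆ ⋃ y ∈ t, (χ y).source := fun A => by
    by_cases hA : A ∈ 𝒮
    · obtain ⟨k, χ, t, h⟩ := (h𝒮.submanifold A hA).exists_countable_charts
      exact ⟨k, χ, t, fun _ => h⟩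
    · exact ⟨0, fun y => chartAt _ y, ∅, fun h => absurd h hA⟩
  choose k χ t h using h𝒮A
  set bad : Set (AffineParam m n) := ⋃ A ∈ 𝒮, ⋃ y ∈ t A, ⋃ i ∈ {i : Fin n | k A ≤ (i : ℕ)},
    degenerateParams (ψ ∘ f ∘ φ.symm) (φ.target ∩ φ.symm ⁻¹' (f ⁻¹' ψ.source))
      (ψ ∘ (χ A y).symm) ((χ A y).target ∩ (χ A y).symm ⁻¹' ψ.source) (k A) i with hbad
  have hnull : μ bad = 0 := by
    refine (measure_biUnion_null_iff h𝒮.countable).2 fun A hA => ?_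
    refine (measure_biUnion_null_iff (h A hA).1).2 fun y hy => ?_
    refine (measure_biUnion_null_iff (Set.to_countable _)).2 fun i hi => ?_
    refine measure_degenerateParams
      (φ.isOpen_inter_preimage_symm (ψ.open_source.preimage f.contMDiff.continuous))
      (fun z hz => (contDiffAt_chart_comp hφ hψ f hz.1 hz.2).contDiffWithinAt)
      ((χ A y).isOpen_inter_preimage_symm ψ.open_source)
      (fun z hz => (contDiffAt_chart_comp_symm hψ ((h A hA).2.1 y hy).1 hz.1
        hz.2).contDiffWithinAt) hi μ
  obtain ⟨p, ⟨hpO, hpC⟩, hpbad⟩ : ∃ p ∈ F ⁻¹' O ∩ {p | ∀ x ∈ C, F p x ∈ ψ.source ∧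
      ∀ᶠ z in 𝓝 x, ψ (F p z) = ψ (f z) + (p.1 + p.2 (φ z))}, p ∉ bad := by
    -- The admissible parameters form a neighbourhood of 0, which has positive Haar measure and so
    -- is not contained in the null set `bad`.
    by_contra hcon
    push Not at hcon
    exact (Measure.measure_pos_of_mem_nhds μ (inter_mem hgood hFC)).ne'
      (measure_mono_null hcon hnull)
  refine ⟨F p, hpO, hFD p, fun x hx A hA => ?_⟩
  by_contra hnot
  have hgA : F p x ∈ A := (Classical.not_imp.1 hnot).1
  obtain ⟨y, hy, hyx⟩ := mem_iUnion₂.1 ((h A hA).2.2 hgA)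
  have hxD := interior_subset (hCD hx)
  obtain ⟨i, hi, hpi⟩ := exists_mem_degenerateParams hφ hψ ((h A hA).2.1 y hy).1
    ((h A hA).2.1 y hy).2 (hDφ hxD) (hDψ hxD) (hpC x hx).1 hyx (hpC x hx).2 hnot
  exact hpbad (mem_iUnion₂.2 ⟨A, hA, mem_iUnion₂.2 ⟨y, hy, mem_iUnion₂.2 ⟨i, hi, hpi⟩⟩⟩)

end

/-! ### Density of transversality -/

section

variable {m n : ℕ} {M N : Type*}
  [TopologicalSpace M] [ChartedSpace (Euc m) M]
  [TopologicalSpace N] [ChartedSpace (Euc n) N]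

/-- A sequence of smooth maps in which the `j`-th step changes the map only inside the `j`-th member
of a locally finite family is locally eventually constant. -/
theorem exists_limit_of_locallyFinite {G : ℕ → C^∞⟮𝓡 m, M; 𝓡 n, N⟯} {U : ℕ → Set M}
    (hU : LocallyFinite U) (hG : ∀ j, ∀ x ∉ U j, G (j + 1) x = G j x) :
    ∃ g : C^∞⟮𝓡 m, M; 𝓡 n, N⟯, ∀ x, ∃ t ∈ 𝓝 x, ∃ J, ∀ j ≥ J, ∀ z ∈ t, G j z = g z := by
  have h1 : ∀ x, ∃ t ∈ 𝓝 x, ∃ J, ∀ j ≥ J, ∀ z ∈ t, G j z = G J z := by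
    intro x
    obtain ⟨t, ht, hfin⟩ := hU x
    obtain ⟨J, hJ⟩ := hfin.bddAbove
    -- J bounds the indices whose set meets t, so from J + 1 on no step changes the map on t.
    refine ⟨t, ht, J + 1, fun j hj z hz => ?_⟩
    induction j, hj using Nat.le_induction with
    | base => rfl
    | succ j hj ih =>
      rw [hG j z fun hzU => ?_, ih]
      have : j ≤ J := hJ ⟨z, hzU, hz⟩
      omega
  choose t ht J hJ using h1
  have h2 : ∀ x, ∀ j ≥ J x, ∀ z ∈ t x, G j z = G (J z) z := by
    intro x j hj z hz
    have h3 := hJ x (max j (J z)) (hj.trans (le_max_left _ _)) z hz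
    have h4 := hJ z (max j (J z)) (le_max_right _ _) z (mem_of_mem_nhds (ht z))
    rw [hJ x j hj z hz, ← h3, h4]
  refine ⟨⟨fun x => G (J x) x, fun x => ?_⟩, fun x => ⟨t x, ht x, J x, h2 x⟩⟩
  refine ((G (J x)).contMDiff x).congr_of_eventuallyEq ?_
  filter_upwards [ht x] with z hz
  exact (h2 x (J x) le_rfl z hz).symm

theorem exists_forall_eventuallyEq_of_isCompact {G : ℕ → C^∞⟮𝓡 m, M; 𝓡 n, N⟯}
    {g : C^∞⟮𝓡 m, M; 𝓡 n, N⟯}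
    (hg : ∀ x, ∃ t ∈ 𝓝 x, ∃ J, ∀ j ≥ J, ∀ z ∈ t, G j z = g z) {K : Set M} (hK : IsCompact K) :
    ∃ J, ∀ j ≥ J, ∀ x ∈ K, G j =ᶠ[𝓝 x] g := by
  choose t ht J hJ using hg
  obtain ⟨s, -, hs⟩ := hK.elim_nhds_subcover (fun x => interior (t x))
    fun x _ => interior_mem_nhds.2 (ht x)
  refine ⟨s.sup J, fun j hj x hx => ?_⟩
  obtain ⟨y, hy, hxy⟩ := mem_iUnion₂.1 (hs hx)
  filter_upwards [isOpen_interior.mem_nhds hxy] with z hz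
  exact hJ y j ((Finset.le_sup hy).trans hj) z (interior_subset hz)

theorem dense_weakTopology_of_dense_strongTopology {T : Set C^∞⟮𝓡 m, M; 𝓡 n, N⟯}
    (hT : @Dense _ (strongTopology m n M N) T) : @Dense _ (weakTopology m n M N) T :=
  fun f => (@mem_closure_iff _ (weakTopology m n M N) _ _).2 fun O hO hfO =>
    (@mem_closure_iff _ (strongTopology m n M N) _ _).1 (hT f) O
      (strongTopology_le_weakTopology O hO) hfO

variable [IsManifold (𝓡 m) ∞ M] [IsManifold (𝓡 n) ∞ N]

theorem TransverseAt.congr_of_eventuallyEq {f g : C^∞⟮𝓡 m, M; 𝓡 n, N⟯} {A : Set N} {x : M}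
    (hf : TransverseAt f A x) (h : f =ᶠ[𝓝 x] g) : TransverseAt g A x := by
  intro hgA
  have hx := mem_chart_source (Euc m) x
  have hφ := IsManifold.chart_mem_maximalAtlas (I := 𝓡 m) (n := ∞) x
  have hψ := IsManifold.chart_mem_maximalAtlas (I := 𝓡 n) (n := ∞) (g x)
  have hgx := mem_chart_source (Euc n) (g x)
  have hfg : f x = g x := h.eq_of_nhds
  have h1 := (sup_range_eq_top_iff hφ hψ f A hx (hfg ▸ hgx)).1 (hf (hfg ▸ hgA))
  refine (sup_range_eq_top_iff hφ hψ g A hx hgx).2 ?_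
  have ht : Tendsto (chartAt (Euc m) x).symm (𝓝 (chartAt (Euc m) x x)) (𝓝 x) := by
    simpa [ContinuousAt, (chartAt (Euc m) x).left_inv hx] using
      (chartAt (Euc m) x).continuousAt_symm ((chartAt (Euc m) x).map_source hx)
  have hev : chartAt (Euc n) (g x) ∘ f ∘ (chartAt (Euc m) x).symm
      =ᶠ[𝓝 (chartAt (Euc m) x x)] chartAt (Euc n) (g x) ∘ g ∘ (chartAt (Euc m) x).symm := by
    filter_upwards [ht.eventually h] with z hz
    simp [hz]
  rw [hev.fderiv_eq, hfg] at h1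
  exact h1

theorem dense_strongTopology_transverseMaps [LocallyCompactSpace M] [T2Space M]
    [SecondCountableTopology M] [SecondCountableTopology N] {𝒮 : Set (Set N)} {S : Set N}
    (hS : IsClosed S) (h𝒮 : IsStratification n 𝒮 S) (hreg : IsARegular n 𝒮) :
    @Dense _ (strongTopology m n M N) (transverseMaps m n 𝒮 (univ : Set M)) := by
  let τ := strongTopology m n M N
  rcases isEmpty_or_nonempty M with hM | hM
  · convert dense_univ
    exact eq_univ_of_forall fun f x => isEmptyElim x
  refine (TopologicalSpace.isTopologicalBasis_of_subbasis rfl).dense_iff.2 ?_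
  rintro _ ⟨𝓕, ⟨h𝓕fin, h𝓕⟩, rfl⟩ ⟨f, hf⟩
  obtain ⟨c, U, C, hUo, hCc, hCU, hUV, hUf, hCcov⟩ := exists_locallyFinite_compact_cover
    (fun x => (chartAt (Euc m) x).source ∩ f ⁻¹' (chartAt (Euc n) (f x)).source)
    fun x => inter_mem (chart_source_mem_nhds _ x)
      (f.contMDiff.continuous.continuousAt.preimage_mem_nhds (chart_source_mem_nhds _ (f x)))
  choose D hDc hCD hDU using fun j => exists_compact_between (hCc j) (hUo j) (hCU j)
  have hDφ : ∀ j, D j ⊆ (chartAt (Euc m) (c j)).source := fun j x hx => (hUV j (hDU j hx)).1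
  have hDψ : ∀ j, MapsTo f (D j) (chartAt (Euc n) (f (c j))).source :=
    fun j x hx => (hUV j (hDU j hx)).2
  -- Only the condition that D j is mapped into the fixed chart domain matters, so order 0 and ε = 1
  -- suffice. It lets the same charts be used for every map in the sequence.
  set W : Set C^∞⟮𝓡 m, M; 𝓡 n, N⟯ := ⋂ j, chartNhd 0 f ((chartAt (Euc m) (c j)).restr (U j))
    (chartAt (Euc n) (f (c j))) (D j) 1 with hW
  have hWo : IsOpen W := by
    refine TopologicalSpace.isOpen_generateFrom_of_mem ⟨0, f, ℕ, _, _, D, fun _ => 1, ?_,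
      fun j => ⟨restr_mem_maximalAtlas _ (IsManifold.chart_mem_maximalAtlas (c j)) (hUo j),
        IsManifold.chart_mem_maximalAtlas (f (c j)), hDc j, fun x hx => ?_, hDψ j, one_pos⟩, rfl⟩
    · refine hUf.subset fun j => ?_
      rw [OpenPartialHomeomorph.restr_source' _ _ (hUo j)]
      exact inter_subset_right
    · rw [OpenPartialHomeomorph.restr_source' _ _ (hUo j)]
      exact ⟨hDφ j hx, hDU j hx⟩
  have hfW : f ∈ W := mem_iInter.2 fun j => self_mem_chartNhd (hDψ j) one_pos
  have h𝓕o : IsOpen (⋂₀ 𝓕) := h𝓕fin.isOpen_sInter fun s hs =>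
    TopologicalSpace.isOpen_generateFrom_of_mem (h𝓕 hs)
  -- Transversality over the pieces already treated; `T 0` imposes nothing. Openness of `T j` lets
  -- step j keep what was gained before.
  set T : ℕ → Set C^∞⟮𝓡 m, M; 𝓡 n, N⟯ := fun j => transverseMaps m n 𝒮 (⋃ i ∈ Iio j, C i) with hT
  have hTo : ∀ j, IsOpen (T j) := fun j =>
    isOpen_strongTopology_transverseMaps hS h𝒮 hreg
      ((finite_Iio j).isCompact_biUnion fun i _ => hCc i).isClosed
  have hstep : ∀ (j : ℕ) (g : C^∞⟮𝓡 m, M; 𝓡 n, N⟯), ∃ g' : C^∞⟮𝓡 m, M; 𝓡 n, N⟯,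
      g ∈ (⋂₀ 𝓕 ∩ W) ∩ T j → g' ∈ (⋂₀ 𝓕 ∩ W) ∩ T (j + 1) ∧ ∀ x ∉ U j, g' x = g x := by
    intro j g
    by_cases hg : g ∈ (⋂₀ 𝓕 ∩ W) ∩ T j
    · obtain ⟨g', hg'O, hg'D, hg'C⟩ := exists_transverse_perturbation h𝒮 g
        (IsManifold.chart_mem_maximalAtlas (c j)) (IsManifold.chart_mem_maximalAtlas (f (c j)))
        (hCc j).isClosed (hDc j) (hCD j) (hDφ j) (mem_iInter.1 hg.1.2 j).1
        (((h𝓕o.inter hWo).inter (hTo j)).mem_nhds hg)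
      refine ⟨g', fun _ => ⟨⟨hg'O.1, fun x hx => ?_⟩, fun x hx => hg'D x fun h => hx (hDU j h)⟩⟩
      obtain ⟨i, hi, hxi⟩ := mem_iUnion₂.1 hx
      rcases (Nat.lt_succ_iff_lt_or_eq.1 hi) with hij | rfl
      · exact hg'O.2 x (mem_iUnion₂.2 ⟨i, hij, hxi⟩)
      · exact hg'C x hxi
    · exact ⟨g, fun h => absurd h hg⟩
  choose next hnext using hstep
  set G : ℕ → C^∞⟮𝓡 m, M; 𝓡 n, N⟯ := fun j => Nat.rec f next j with hGdef
  have hG : ∀ j, G j ∈ (⋂₀ 𝓕 ∩ W) ∩ T j := by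
    intro j
    induction j with
    | zero =>
      refine ⟨⟨hf, hfW⟩, fun x hx => ?_⟩
      simp at hx
    | succ j ih => exact (hnext j (G j) ih).1
  obtain ⟨g, hg⟩ := exists_limit_of_locallyFinite (G := G) hUf fun j => (hnext j (G j) (hG j)).2
  refine ⟨g, fun s hs => ?_, fun x _ A hA => ?_⟩
  · have hGs : ∀ j, G j ∈ s := fun j => (hG j).1.1 s hs
    obtain ⟨r, f', ι, φ, ψ, K, ε, -, h, rfl⟩ := h𝓕 hs
    refine mem_iInter.2 fun i => ?_
    -- J may depend on i, because every map of the sequence satisfies all the conditions.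
    obtain ⟨J, hJ⟩ := exists_forall_eventuallyEq_of_isCompact hg (h i).2.2.1
    exact mem_chartNhd_of_eventuallyEq (h i).2.2.2.1 (mem_iInter.1 (hGs J) i) (hJ J le_rfl)
  · obtain ⟨i, hi⟩ := mem_iUnion.1 (hCcov ▸ mem_univ x)
    obtain ⟨t, ht, J, hJ⟩ := hg x
    have h1 : G (max J (i + 1)) =ᶠ[𝓝 x] g := by
      filter_upwards [ht] with z hz
      exact hJ _ (le_max_left _ _) z hz
    exact ((hG (max J (i + 1))).2 x (mem_iUnion₂.2
      ⟨i, lt_of_lt_of_le (Nat.lt_succ_self i) (le_max_right _ _), hi⟩) A hA).congr_of_eventuallyEq h1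

end

end StratTransverse

end

theorem proposition1p2 (m n : ℕ) (M N : Type*)
    [TopologicalSpace M] [ChartedSpace (StratTransverse.Euc m) M] [IsManifold (𝓡 m) ∞ M]
    [T2Space M] [SecondCountableTopology M]
    [TopologicalSpace N] [ChartedSpace (StratTransverse.Euc n) N] [IsManifold (𝓡 n) ∞ N]
    [T2Space N] [SecondCountableTopology N]
    (𝒮 : Set (Set N)) (S : Set N) (hS : IsClosed S)
    (h𝒮 : StratTransverse.IsStratification n 𝒮 S) (hreg : StratTransverse.IsARegular n 𝒮) :
    (@Dense _ (StratTransverse.weakTopology m n M N)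
        (StratTransverse.transverseMaps m n 𝒮 (univ : Set M)) ∧
      @Dense _ (StratTransverse.strongTopology m n M N)
        (StratTransverse.transverseMaps m n 𝒮 (univ : Set M))) ∧
    ∀ K : Set M,
      (IsCompact K → IsOpen[StratTransverse.weakTopology m n M N]
        (StratTransverse.transverseMaps m n 𝒮 K)) ∧
      (IsClosed K → IsOpen[StratTransverse.strongTopology m n M N]
        (StratTransverse.transverseMaps m n 𝒮 K)) := by
  have : LocallyCompactSpace M := ChartedSpace.locallyCompactSpace (StratTransverse.Euc m) M
  have hdense := StratTransverse.dense_strongTopology_transverseMaps (m := m) (M := M) hS h𝒮 hreg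
  exact ⟨⟨StratTransverse.dense_weakTopology_of_dense_strongTopology hdense, hdense⟩,
    fun K => ⟨StratTransverse.isOpen_weakTopology_transverseMaps hS h𝒮 hreg,
      StratTransverse.isOpen_strongTopology_transverseMaps hS h𝒮 hreg⟩⟩
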